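/- **Setting.** Let $\mathbb N=\{1,2,\dots\}$. Let $a=(a_j)_{j\ge1}$ be a non-decreasing sequence of positive reals with $a_j\to\infty$, let $b=(b_j)_{j\ge 1}$ be a sequence of positive reals, and let $0<C_0\le 1\le C_1<\infty$. Put $\mathcal B(b)=\{\nu\in\mathbb R^{\mathbb N}: C_0b_j\le \nu_j\le C_1b_j\ \forall j\}$ (so $\mathcal B(b)=\{b\}$ if $C_0=C_1=1$), $\mathcal E_a=\{\theta\in\ell^2(\mathbb N):\sum_j a_j^2\theta_j^2\le 1\}$ and $\Theta_a(r)=\{\theta\in\mathcal E_a:\|\theta\|\ge r\}$. For $\varepsilon,\sigma>0$, $\theta\in\ell^2(\mathbb N)$ and $\nu\in\mathcal B(b)$, let $\mathbb P_{\theta,\nu}$ be the law of the observations $$Y_j=\nu_j\theta_j+\varepsilon\xi_j,\qquad X_j=\nu_j+\sigma\eta_j,\qquad j\in\mathbb N,$$ with independent standard Gaussian $\xi_j,\eta_j$. The benchmark $\theta_0\in\mathcal E_a\setminus\{0\}$ is known, and the singular values $\nu$ are known only to lie in $\mathcal B(b)$. A procedure $\Psi$ assigns to each $\theta_0\in\mathcal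 E_a\setminus\{0\}$ a measurable $\{0,1\}$-valued function $\Psi_{\theta_0}$ of $(Y,X)$ that tests $H_0:\theta=\theta_0$ against $H_1:\theta-\theta_0\in\Theta_a(r)$. It has level $\alpha$ if $\mathbb P_{\theta_0,\nu}(\Psi_{\theta_0}=1)\le\alpha$ for all $\theta_0\in\mathcal E_a\setminus\{0\}$ and $\nu\in\mathcal B(b)$. The minimax separation radius $\tilde r_{\varepsilon,\sigma}$ is the infimum, over all procedures $\Psi$ of level $\alpha$, of $$\inf\Big\{r>0:\ \sup_{\theta_0\in\mathcal E_a\setminus\{0\}}\ \sup_{\theta-\theta_0\in\Theta_a(r)}\ \sup_{\nu\in\mathcal B(b)}\mathbb P_{\theta,\nu}(\Psi_{\theta_0}=0)\le\beta\Big\}.$$ **Constants and bandwidths.** Let $\kappa=5(3\pi^2+12)/6$, $h_{0,j}=18\sqrt{\ln(\kappa j^2/\alpha)}+\sqrt{2\ln(10/\alpha)}$, $h_{1,j}=16\sqrt{\ln(\kappa j^2/\alpha)}$, $$M_0=\inf\{j: b_j\le\sigma h_{0,j}\}-1,\qquad M_1=\inf\{j:b_j\le \sigma h_{1,j}\}\qquad(\inf\emptyset=\infty),$$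 $$\tilde C=\tfrac{16}{C_0^{2}}\Big(3\sqrt{\ln(2/\alpha)}+2\ln(2/\alpha)+3\sqrt{\ln(2/\beta)}\Big),$$ $$C_{\alpha,\beta}=\ln\big(1+4(1-\alpha-\beta)^2\big),\qquad c_{\alpha,\beta}=\sqrt{2\ln\big(1+4(1-\alpha-\beta)^2\big)},$$ $$M_2=\sup\Big\{D\in\mathbb N:\ C_{\alpha,\beta}\,\sigma b_D^{-1}\le 2,\ \ \frac1{\sigma\sqrt{2\pi}}\int_{C_0b_D}^{C_1b_D}e^{-(t-b_D)^2/(2\sigma^2)}dt\ \ge\ \frac1{\sqrt{1+4(1-\alpha-\beta)^2}}\Big\}\qquad(\sup\emptyset=0),$$ and $a_0^{-2}:=+\infty$; a maximum over the empty set is $0$. **Theorem.** Let $0<\alpha\le\beta<1$. (i) Suppose that $C_0=C_1=1$, or that there is a constant $K$ with $(a_jb_j)^{-1}\le K\max\{1,(a_kb_k)^{-1}\}$ for all $j\le k$. Then there is $\sigma_0\in\,]0,1[$ (depending on $\alpha,\beta,a,b,C_0,C_1$) such that, for all $0<\sigma\le\sigma_0$ and all $\varepsilon>0$, $$\tilde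 r_{\varepsilon,\sigma}^2\le\inf_{D\in\mathbb N}\Big[\tilde C\,\varepsilon^2\sqrt{\textstyle\sum_{j=1}^{D\wedge M_1}b_j^{-4}}+\big(7+4\sqrt{\ln(2/\alpha)}\big)\big[\sigma^2\ln^{3/2}(1/\sigma)\vee a_{D\wedge M_0}^{-2}\big]\Big].$$ (ii) Suppose that $\alpha+\beta<1$ and that $b$ is non-increasing. Then, for all $\varepsilon,\sigma>0$, $$\tilde r_{\varepsilon,\sigma}^2\ge\Big\{\frac{C_{\alpha,\beta}^2}{16}\,\sigma^2\max_{1\le D\le M_2}b_D^{-2}a_D^{-2}\Big\}\vee\Big\{\sup_{D\in\mathbb N}\Big[c_{\alpha,\beta}\,\varepsilon^2\sqrt{\textstyle\sum_{j=1}^{D}b_j^{-4}}\ \wedge\ a_D^{-2}\Big]\Big\}.$$ -/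

import Mathlib

open MeasureTheory ProbabilityTheory Filter
open scoped ENNReal NNReal

noncomputable section

namespace GoF

/-- Square-summable real sequences indexed by `{1, 2, …}`, with the Hilbert norm. -/
abbrev EllTwo : Type := lp (fun _ : ℕ+ => ℝ) 2

/-- The space of observations `(Y_j, X_j)_{j ≥ 1}`. -/
abbrev Obs : Type := ℕ+ → ℝ × ℝ

/-- The joint law `P_{θ,b}` of the observations `Y_j = b_j θ_j + ε ξ_j`, `X_j = b_j + σ η_j`,
with `ξ_j`, `η_j` (`j ≥ 1`) independent standard Gaussian variables. -/
def law (ε σ : ℝ) (θ : EllTwo) (b : ℕ+ → ℝ) : Measure Obs :=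
  Measure.infinitePi fun j : ℕ+ =>
    (gaussianReal (b j * θ j) (Real.toNNReal (ε ^ 2))).prod
      (gaussianReal (b j) (Real.toNNReal (σ ^ 2)))

/-- The ellipsoid `E_a = {θ ∈ ℓ² : ∑ a_j² θ_j² ≤ 1}`. -/
def ellipsoid (a : ℕ+ → ℝ) : Set EllTwo :=
  {θ | Summable (fun j : ℕ+ => a j ^ 2 * θ j ^ 2) ∧ ∑' j : ℕ+, a j ^ 2 * θ j ^ 2 ≤ 1}

/-- `Θ_a(r)`: the ellipsoid with a ball of radius `r` removed. -/
def alternatives (a : ℕ+ → ℝ) (r : ℝ) : Set EllTwo :=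
  {θ | θ ∈ ellipsoid a ∧ r ≤ ‖θ‖}

/-- `B(b)`: the positive sequences that are comparable to `b` with constants `C₀`, `C₁`.
The true (unknown) sequence of singular values ranges over this set. For `C₀ = C₁ = 1` it is
`{b}`. -/
def operatorClass (C₀ C₁ : ℝ) (b : ℕ+ → ℝ) : Set (ℕ+ → ℝ) :=
  {ν | ∀ j, C₀ * b j ≤ ν j ∧ ν j ≤ C₁ * b j}

/-- The benchmark signals: non-zero elements of the ellipsoid. -/
def benchmarks (a : ℕ+ → ℝ) : Set EllTwo := {θ₀ | θ₀ ∈ ellipsoid a ∧ θ₀ ≠ 0}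

/-- A goodness-of-fit testing procedure: for each benchmark `θ₀` a non-randomized decision about
`H₀ : θ = θ₀`, as a function of the observations (`true` means that `H₀` is rejected). -/
abbrev Procedure : Type := EllTwo → Obs → Bool

/-- `Ψ` is a measurable procedure of level `α`, whatever the benchmark and whatever the singular
values in the class `B`. -/
def IsLevelTest (a : ℕ+ → ℝ) (B : Set (ℕ+ → ℝ)) (α ε σ : ℝ) (Ψ : Procedure) : Prop :=
  (∀ θ₀, Measurable (Ψ θ₀)) ∧
    ∀ θ₀ ∈ benchmarks a, ∀ ν ∈ B, law ε σ θ₀ ν {z | Ψ θ₀ z = true} ≤ ENNReal.ofReal α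

/-- The maximal second kind error probability of `Ψ` at radius `r`. -/
def secondKind (a : ℕ+ → ℝ) (B : Set (ℕ+ → ℝ)) (ε σ : ℝ) (Ψ : Procedure) (r : ℝ) : ℝ≥0∞ :=
  ⨆ θ₀ ∈ benchmarks a, ⨆ (θ : EllTwo) (_ : θ - θ₀ ∈ alternatives a r), ⨆ ν ∈ B,
    law ε σ θ ν {z | Ψ θ₀ z = false}

/-- The separation radius of `Ψ`. -/
def separationRadius (a : ℕ+ → ℝ) (B : Set (ℕ+ → ℝ)) (β ε σ : ℝ) (Ψ : Procedure) : ℝ≥0∞ :=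
  ⨅ (r : ℝ) (_ : 0 < r ∧ secondKind a B ε σ Ψ r ≤ ENNReal.ofReal β), ENNReal.ofReal r

/-- The minimax separation radius over the ellipsoid and the class `B` of singular values. -/
def minimaxRadius (a : ℕ+ → ℝ) (B : Set (ℕ+ → ℝ)) (α β ε σ : ℝ) : ℝ≥0∞ :=
  ⨅ (Ψ : Procedure) (_ : IsLevelTest a B α ε σ Ψ), separationRadius a B β ε σ Ψ

/-- `κ = 5 (3 π² + 12) / 6`. -/
def kappa : ℝ := 5 * (3 * Real.pi ^ 2 + 12) / 6

/-- `h_{0,j}`. -/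
def hZero (α : ℝ) (j : ℕ+) : ℝ :=
  18 * √(Real.log (kappa * (j : ℝ) ^ 2 / α)) + √(2 * Real.log (10 / α))

/-- `h_{1,j}`. -/
def hOne (α : ℝ) (j : ℕ+) : ℝ := 16 * √(Real.log (kappa * (j : ℝ) ^ 2 / α))

/-- `M₀ = inf {j ≥ 1 : b_j ≤ σ h_{0,j}} - 1` (infinite if there is no such `j`). -/
def bandM₀ (α σ : ℝ) (b : ℕ+ → ℝ) : ℕ∞ :=
  (⨅ (j : ℕ+) (_ : b j ≤ σ * hZero α j), ((j : ℕ) : ℕ∞)) - 1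

/-- `M₁ = inf {j ≥ 1 : b_j ≤ σ h_{1,j}}` (infinite if there is no such `j`). -/
def bandM₁ (α σ : ℝ) (b : ℕ+ → ℝ) : ℕ∞ :=
  ⨅ (j : ℕ+) (_ : b j ≤ σ * hOne α j), ((j : ℕ) : ℕ∞)

/-- `C_{α,β} = ln (1 + 4 (1 - α - β)²)`. -/
def bigC (α β : ℝ) : ℝ := Real.log (1 + 4 * (1 - α - β) ^ 2)

/-- `c_{α,β} = (2 ln (1 + 4 (1 - α - β)²))^{1/2}`. -/
def smallC (α β : ℝ) : ℝ := √(2 * Real.log (1 + 4 * (1 - α - β) ^ 2))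

/-- `C̃ = 16 C₀⁻² (3 √x_{α/2} + 2 x_{α/2} + 3 √x_{β/2})` with `x_γ = ln (1/γ)`. -/
def tildeC (α β C₀ : ℝ) : ℝ :=
  16 * (3 * √(Real.log (2 / α)) + 2 * Real.log (2 / α) + 3 * √(Real.log (2 / β))) / C₀ ^ 2

/-- `G_D(C₀, C₁)`: the mass that the Gaussian law with mean `b_D` and variance `σ²` gives to
`[C₀ b_D, C₁ b_D]`. -/
def gaussMass (C₀ C₁ σ : ℝ) (b : ℕ+ → ℝ) (D : ℕ+) : ℝ :=
  1 / (σ * √(2 * Real.pi)) *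
    ∫ t in (C₀ * b D)..(C₁ * b D), Real.exp (-(1 / (2 * σ ^ 2)) * (t - b D) ^ 2)

/-- `M₂ = sup {D ≥ 1 : C_{α,β} σ b_D⁻¹ ≤ 2 and G_D(C₀, C₁) ≥ (1 + 4 (1 - α - β)²)^{-1/2}}`
(zero if there is no such `D`). -/
def bandM₂ (α β C₀ C₁ σ : ℝ) (b : ℕ+ → ℝ) : ℕ∞ :=
  ⨆ (D : ℕ+) (_ : bigC α β * σ * (b D)⁻¹ ≤ 2 ∧
    1 / √(1 + 4 * (1 - α - β) ^ 2) ≤ gaussMass C₀ C₁ σ b D), ((D : ℕ) : ℕ∞)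

/-- `a_n⁻²`, with the convention `a_0⁻² = ∞`. -/
def invSq (a : ℕ+ → ℝ) (n : ℕ) : ℝ≥0∞ :=
  if h : 0 < n then ENNReal.ofReal ((a ⟨n, h⟩ ^ 2)⁻¹) else ⊤

/-- The bracket of the upper bound, for a given cut-off `D`. -/
def upperTerm (a b : ℕ+ → ℝ) (α β C₀ ε σ : ℝ) (D : ℕ+) : ℝ≥0∞ :=
  ENNReal.ofReal (tildeC α β C₀ * ε ^ 2 *
      √(∑ j ∈ (Finset.Icc 1 D).filter (fun j : ℕ+ => ((j : ℕ) : ℕ∞) ≤ bandM₁ α σ b),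
        (b j ^ 4)⁻¹)) +
    ENNReal.ofReal (7 + 4 * √(Real.log (2 / α))) *
      max (ENNReal.ofReal (σ ^ 2 * Real.log (1 / σ) ^ (3 / 2 : ℝ)))
        (invSq a (min ((D : ℕ) : ℕ∞) (bandM₀ α σ b)).toNat)

/-- The part of the lower bound that is due to the noise on the singular values. -/
def lowerSigma (a b : ℕ+ → ℝ) (α β C₀ C₁ σ : ℝ) : ℝ≥0∞ :=
  ⨆ (D : ℕ+) (_ : ((D : ℕ) : ℕ∞) ≤ bandM₂ α β C₀ C₁ σ b),
    ENNReal.ofReal (bigC α β ^ 2 / 16 * σ ^ 2 * ((b D ^ 2)⁻¹ * (a D ^ 2)⁻¹))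

/-- The part of the lower bound that is due to the noise on the signal. -/
def lowerEps (a b : ℕ+ → ℝ) (α β ε : ℝ) : ℝ≥0∞ :=
  ⨆ D : ℕ+, ENNReal.ofReal
    (min (smallC α β * ε ^ 2 * √(∑ j ∈ Finset.Icc 1 D, (b j ^ 4)⁻¹)) (a D ^ 2)⁻¹)

/-- The sequence `(a_j b_j)⁻¹` is bounded or non-decreasing, up to constants:
`(a_j b_j)⁻¹ ≤ K max(1, (a_k b_k)⁻¹)` for all `j ≤ k`. -/
def BoundedOrAlmostMonotone (a b : ℕ+ → ℝ) : Prop :=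
  ∃ K : ℝ, ∀ j k : ℕ+, j ≤ k → (a j * b j)⁻¹ ≤ K * max 1 (a k * b k)⁻¹

end GoF

end

/-! Upper bound. The residuals `Y_j - θ₀_j X_j` are Gaussian with mean `ν_j (θ_j - θ₀_j)` and
variance `ε² + σ² θ₀_j²`. The variance is known and the mean vanishes under the null hypothesis, so
a test can be built without estimating `ν`. The test is a chi-square sum over `j ≤ N = D ∧ M₀` with
weights proportional to `b_j⁻²`. Exponential moments of squared Gaussians and Markov's inequality
control both errors (`measure_chiSquareStat_ge_le`, `measure_chiSquareStat_lt_le`). Truncation at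
`N` costs `a_N⁻²`. The size of the noise is the ℓ² norm of the variances divided by `b_j²`: the `ε`
part gives the root of `∑ b_j⁻⁴`, and since `∑ a_j² θ₀_j² ≤ 1` the `σ` part is at most `σ² max (a_j
b_j)⁻²` (`sum_weights_sq_le`).

It remains to absorb this `σ` part into the remainder. By the hypothesis on `(a_j b_j)⁻¹` it has
order `σ²` or `σ² (a_N b_N)⁻²`. The first is below `σ² ln^{3/2}(1/σ)` for small `σ`. For the second,
`b_N > σ h_{0,N}` gives the bound `a_N⁻² / h_{0,N}²`, which suffices once `h_{0,N}` is large; the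
finitely many other `N` are handled by taking `σ` small. If `C₀ = C₁ = 1`, the residuals `Y_j - b_j
θ₀_j` have no `σ` part at all.

Lower bound. If the level and the second kind error hold simultaneously, then `1 - α - β` is at most
half the root of a chi-square divergence (`one_sub_errors_le`). For the `σ` term, change `ν_D` and
`θ_D` so that `ν_D θ_D` stays fixed: `Y` keeps its law and only `X_D` is shifted, by a fraction of
`σ`. For the `ε` term, perturb a benchmark by independent random signs with amplitudes proportional
to `b_j⁻²`; each coordinate contributes a hyperbolic cosine to the chi-square divergence
(`one_sub_errors_le_of_signs`). -/

namespace GoF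

/-! ### Infinite product measures: finite-coordinate densities and mixtures -/

section ProductMeasures

variable {ι : Type*} {X : ι → Type*} [∀ i, MeasurableSpace (X i)]

theorem lintegral_infinitePi_prod (μ : ∀ i, Measure (X i)) [∀ i, IsProbabilityMeasure (μ i)]
    (s : Finset ι) (f : ∀ i, X i → ℝ≥0∞) (hf : ∀ i, Measurable (f i)) :
    ∫⁻ z, ∏ i ∈ s, f i (z i) ∂(Measure.infinitePi μ) = ∏ i ∈ s, ∫⁻ x, f i x ∂(μ i) := by
  have hind : iIndepFun (fun i (z : ∀ i, X i) => f i (z i)) (Measure.infinitePi μ) :=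
    iIndepFun_infinitePi hf
  rw [lintegral_prod_eq_prod_lintegral_of_indepFun s _ hind
    fun i => (hf i).comp (measurable_pi_apply i)]
  refine Finset.prod_congr rfl fun i _ => ?_
  exact (measurePreserving_eval_infinitePi μ i).lintegral_comp (hf i)

/-- A product measure is determined by its values on finite boxes, and on a box the integral of the
density factorizes over coordinates. -/
theorem infinitePi_eq_withDensity (μ μ' : ∀ i, Measure (X i)) [∀ i, IsProbabilityMeasure (μ i)]
    [∀ i, IsProbabilityMeasure (μ' i)] (S : Finset ι) (f : ∀ i, X i → ℝ≥0∞)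
    (hf : ∀ i, Measurable (f i)) (hS : ∀ i ∈ S, μ' i = (μ i).withDensity (f i))
    (hS' : ∀ i ∉ S, μ' i = μ i) :
    Measure.infinitePi μ' =
      (Measure.infinitePi μ).withDensity fun z => ∏ i ∈ S, f i (z i) := by
  classical
  refine (Measure.eq_infinitePi μ' fun s t ht => ?_).symm
  have hbox : MeasurableSet (Set.pi (s : Set ι) t) :=
    MeasurableSet.pi s.countable_toSet fun i _ => ht i
  -- One factor per coordinate carries both the side of the box and the density, so that `s` and `S`
  -- may overlap arbitrarily. A coordinate in `S` but not in `s` contributes 1 because `μ' i` has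
  -- total mass 1.
  let g : ∀ i, X i → ℝ≥0∞ := fun i x =>
    (if i ∈ s then (t i).indicator 1 x else 1) * (if i ∈ S then f i x else 1)
  have hg : ∀ i, Measurable (g i) := by
    intro i
    refine Measurable.mul ?_ ?_
    · split_ifs
      · exact measurable_one.indicator (ht i)
      · exact measurable_const
    · split_ifs
      · exact hf i
      · exact measurable_const
  have hprod : ∀ z : ∀ i, X i,
      (Set.pi (s : Set ι) t).indicator (fun z => ∏ i ∈ S, f i (z i)) z =
        ∏ i ∈ s ∪ S, g i (z i) := by
    intro z
    have h1 : ∏ i ∈ s ∪ S, g i (z i) =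
        (∏ i ∈ s, (t i).indicator (1 : X i → ℝ≥0∞) (z i)) * ∏ i ∈ S, f i (z i) := by
      simp only [g, Finset.prod_mul_distrib]
      congr 1
      · rw [Finset.prod_ite_mem, Finset.inter_eq_right.2 Finset.subset_union_left]
      · rw [Finset.prod_ite_mem, Finset.inter_eq_right.2 Finset.subset_union_right]
    rw [h1]
    by_cases hz : z ∈ Set.pi (s : Set ι) t
    · have hone : ∏ i ∈ s, (t i).indicator (1 : X i → ℝ≥0∞) (z i) = 1 :=
        Finset.prod_eq_one fun i hi => by simp [hz i hi]
      rw [Set.indicator_of_mem hz, hone, one_mul]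
    · rw [Set.indicator_of_notMem hz]
      simp only [Set.mem_pi, not_forall] at hz
      obtain ⟨i, hi, hzi⟩ := hz
      rw [Finset.prod_eq_zero (i := i) hi (by simp [hzi]), zero_mul]
  rw [withDensity_apply _ hbox, ← lintegral_indicator hbox, lintegral_congr hprod,
    lintegral_infinitePi_prod μ _ g hg]
  have hfac : ∀ i, ∫⁻ x, g i x ∂(μ i) = if i ∈ s then μ' i (t i) else 1 := by
    intro i
    by_cases hi : i ∈ s <;> by_cases hiS : i ∈ S
    · simp only [g, hi, hiS, if_true]
      rw [hS i hiS, withDensity_apply _ (ht i), ← lintegral_indicator (ht i)]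
      refine lintegral_congr fun x => ?_
      by_cases hx : x ∈ t i <;> simp [hx]
    · simp only [g, hi, hiS, if_true, if_false, mul_one]
      rw [hS' i hiS, lintegral_indicator_one (ht i)]
    · simp only [g, hi, hiS, if_true, if_false, one_mul]
      rw [← setLIntegral_univ, ← withDensity_apply _ MeasurableSet.univ, ← hS i hiS, measure_univ]
    · simp [g, hi, hiS]
  rw [Finset.prod_congr rfl fun i _ => hfac i, Finset.prod_ite_mem,
    Finset.inter_eq_right.2 Finset.subset_union_left]

theorem infinitePi_update_average [DecidableEq ι] (μ : ∀ i, Measure (X i))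
    [∀ i, IsProbabilityMeasure (μ i)] (k : ι) (p q : Measure (X k))
    [IsProbabilityMeasure p] [IsProbabilityMeasure q]
    (μ₀ μ₁ μ₂ : ∀ i, Measure (X i)) [∀ i, IsProbabilityMeasure (μ₀ i)]
    [∀ i, IsProbabilityMeasure (μ₁ i)] [∀ i, IsProbabilityMeasure (μ₂ i)]
    (h₀ : μ₀ = Function.update μ k ((2⁻¹ : ℝ≥0∞) • (p + q)))
    (h₁ : μ₁ = Function.update μ k p) (h₂ : μ₂ = Function.update μ k q) :
    Measure.infinitePi μ₀ =
      (2⁻¹ : ℝ≥0∞) • (Measure.infinitePi μ₁ + Measure.infinitePi μ₂) := by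
  refine (Measure.eq_infinitePi μ₀ fun s t ht => ?_).symm
  rw [Measure.smul_apply, Measure.add_apply, Measure.infinitePi_pi _ fun i _ => ht i,
    Measure.infinitePi_pi _ fun i _ => ht i, smul_eq_mul, h₀, h₁, h₂]
  by_cases hk : k ∈ s
  · rw [← Finset.mul_prod_erase s _ hk, ← Finset.mul_prod_erase s _ hk,
      ← Finset.mul_prod_erase s _ hk]
    have hrest : ∀ m : Measure (X k), ∏ i ∈ s.erase k, Function.update μ k m i (t i) =
        ∏ i ∈ s.erase k, μ i (t i) := by
      intro m
      refine Finset.prod_congr rfl fun i hi => ?_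
      rw [Function.update_of_ne (Finset.ne_of_mem_erase hi)]
    simp only [hrest, Function.update_self, Measure.smul_apply, Measure.add_apply, smul_eq_mul]
    ring
  · have hrest : ∀ m : Measure (X k), ∏ i ∈ s, Function.update μ k m i (t i) =
        ∏ i ∈ s, μ i (t i) := by
      intro m
      refine Finset.prod_congr rfl fun i hi => ?_
      rw [Function.update_of_ne (ne_of_mem_of_not_mem hi hk)]
    simp only [hrest]
    rw [← two_mul, ← mul_assoc, ENNReal.inv_mul_cancel two_ne_zero ENNReal.ofNat_ne_top, one_mul]

end ProductMeasures

/-- The total variation distance is at most half the root of the chi-square divergence. -/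
theorem measureReal_sub_le_of_lintegral_sq_le {Ω : Type*} [MeasurableSpace Ω]
    (P Q : Measure Ω) [IsProbabilityMeasure P] [IsProbabilityMeasure Q] (L : Ω → ℝ)
    (hL : Measurable L) (hL0 : ∀ z, 0 ≤ L z)
    (hQ : Q = P.withDensity fun z => ENNReal.ofReal (L z)) {η : ℝ} (hη : 0 < η)
    (hsq : ∫⁻ z, ENNReal.ofReal (L z ^ 2) ∂P ≤ ENNReal.ofReal (1 + 4 * η ^ 2))
    {A : Set Ω} (hA : MeasurableSet A) : P.real A - Q.real A ≤ η := by
  have hsqi : Integrable (fun z => L z ^ 2) P := by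
    refine ⟨(hL.pow_const 2).aestronglyMeasurable, ?_⟩
    rw [hasFiniteIntegral_iff_ofReal (ae_of_all _ fun z => sq_nonneg _)]
    exact hsq.trans_lt ENNReal.ofReal_lt_top
  have hLint : ∫⁻ z, ENNReal.ofReal (L z) ∂P = 1 := by
    rw [← setLIntegral_univ, ← withDensity_apply _ MeasurableSet.univ, ← hQ, measure_univ]
  have hLi : Integrable L P := by
    refine ⟨hL.aestronglyMeasurable, ?_⟩
    rw [hasFiniteIntegral_iff_ofReal (ae_of_all _ hL0), hLint]
    exact ENNReal.one_lt_top
  have hI1 : ∫ z, L z ∂P = 1 := by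
    rw [integral_eq_lintegral_of_nonneg_ae (ae_of_all _ hL0) hL.aestronglyMeasurable, hLint]
    rfl
  have hI2 : ∫ z, L z ^ 2 ∂P ≤ 1 + 4 * η ^ 2 := by
    rw [integral_eq_lintegral_of_nonneg_ae (ae_of_all _ fun z => sq_nonneg _)
      (hL.pow_const 2).aestronglyMeasurable]
    exact ENNReal.toReal_le_of_le_ofReal (by positivity) hsq
  have hQA : Q.real A = ∫ z, A.indicator L z ∂P := by
    rw [integral_indicator hA, integral_eq_lintegral_of_nonneg_ae (ae_of_all _ hL0)
      hL.aestronglyMeasurable, measureReal_def, hQ, withDensity_apply _ hA]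
  have hPA : P.real A = ∫ z, A.indicator (1 : Ω → ℝ) z ∂P := (integral_indicator_one hA).symm
  have hPi : Integrable (A.indicator (1 : Ω → ℝ)) P := (integrable_const (1 : ℝ)).indicator hA
  -- The linear part `(1 - L)/2` integrates to zero and the rest bounds `|1 - L|/2`, by the AM-GM
  -- inequality balanced at `|1 - L| = 2η`. This avoids the Cauchy–Schwarz inequality for integrals.
  have hpoint : ∀ z, A.indicator (1 : Ω → ℝ) z - A.indicator L z ≤
      1 / 2 * (1 - L z) + (η / 2 + (1 - 2 * L z + L z ^ 2) / (8 * η)) := by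
    intro z
    have key : |1 - L z| / 2 ≤ η / 2 + (1 - 2 * L z + L z ^ 2) / (8 * η) := by
      rw [div_add_div _ _ two_ne_zero (by positivity), div_le_div_iff₀ two_pos (by positivity)]
      nlinarith [sq_nonneg (2 * η - |1 - L z|), sq_abs (1 - L z)]
    by_cases hz : z ∈ A
    · simp only [Set.indicator_of_mem hz, Pi.one_apply]
      linarith [le_abs_self (1 - L z)]
    · simp only [Set.indicator_of_notMem hz]
      linarith [neg_abs_le (1 - L z)]
  have hrhs : Integrable (fun z => 1 / 2 * (1 - L z) +
      (η / 2 + (1 - 2 * L z + L z ^ 2) / (8 * η))) P :=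
    (((integrable_const _).sub hLi).const_mul _).add ((integrable_const _).add
      ((((integrable_const _).sub (hLi.const_mul _)).add hsqi).div_const _))
  have hmono := integral_mono (hPi.sub (hLi.indicator hA)) hrhs hpoint
  simp only [Pi.sub_apply] at hmono
  rw [integral_sub hPi (hLi.indicator hA), ← hPA, ← hQA] at hmono
  have hval : ∫ z, (1 / 2 * (1 - L z) + (η / 2 + (1 - 2 * L z + L z ^ 2) / (8 * η))) ∂P =
      1 / 2 * (1 - 1) + (η / 2 + (1 - 2 * 1 + ∫ z, L z ^ 2 ∂P) / (8 * η)) := by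
    have i1 : Integrable (fun z => 1 - L z) P := (integrable_const _).sub hLi
    have i2 : Integrable (fun z => 1 - 2 * L z) P := (integrable_const _).sub (hLi.const_mul _)
    have i3 : Integrable (fun z => 1 - 2 * L z + L z ^ 2) P := i2.add hsqi
    have i4 : Integrable (fun z => η / 2 + (1 - 2 * L z + L z ^ 2) / (8 * η)) P :=
      (integrable_const _).add (i3.div_const _)
    rw [integral_add (i1.const_mul _) i4,
      integral_const_mul, integral_sub (integrable_const _) hLi,
      integral_add (integrable_const _) (i3.div_const _), integral_div (8 * η), integral_add i2 hsqi,
      integral_sub (integrable_const _) (hLi.const_mul _), integral_const_mul, hI1]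
    simp
  rw [hval] at hmono
  refine hmono.trans ?_
  have : (1 - 2 * 1 + ∫ z, L z ^ 2 ∂P) / (8 * η) ≤ η / 2 := by
    rw [div_le_div_iff₀ (by positivity) two_pos]
    nlinarith
  linarith

/-! ### Gaussian exponential moments and likelihood ratios -/

section GaussianIntegrals

/-- Completing the square. The sign of `c` is free, so one identity serves both error probabilities.
-/
theorem gaussianPDFReal_mul_exp_neg_sq (m c : ℝ) {v : ℝ≥0} (hv : v ≠ 0) (hc : 0 < 1 + 2 * c * v)
    (x : ℝ) :
    gaussianPDFReal m v x * Real.exp (-c * x ^ 2) =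
      ((√(1 + 2 * c * v))⁻¹ * Real.exp (-c * m ^ 2 / (1 + 2 * c * v))) *
        gaussianPDFReal (m / (1 + 2 * c * v)) (v / (1 + 2 * c * v).toNNReal) x := by
  have hv' : (0 : ℝ) < v := lt_of_le_of_ne v.coe_nonneg (by exact_mod_cast hv.symm)
  have hvv : ((v / (1 + 2 * c * v).toNNReal : ℝ≥0) : ℝ) = v / (1 + 2 * c * v) := by
    rw [NNReal.coe_div, Real.coe_toNNReal _ hc.le]
  rw [gaussianPDFReal_def, gaussianPDFReal_def, hvv]
  set q := 1 + 2 * c * (v : ℝ) with hq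
  have hsqrt : √(2 * Real.pi * (v / q)) = √(2 * Real.pi * v) / √q := by
    rw [← mul_div_assoc, Real.sqrt_div' _ hc.le]
  have hq0 : √q ≠ 0 := (Real.sqrt_pos.2 hc).ne'
  have hp0 : √(2 * Real.pi * v) ≠ 0 := (Real.sqrt_pos.2 (by positivity)).ne'
  rw [hsqrt]
  have hexp : -(x - m) ^ 2 / (2 * v) + -c * x ^ 2 =
      -c * m ^ 2 / q + -(x - m / q) ^ 2 / (2 * (v / q)) := by
    field_simp
    rw [hq]
    ring
  have e1 : Real.exp (-(x - m) ^ 2 / (2 * v)) * Real.exp (-c * x ^ 2) =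
      Real.exp (-c * m ^ 2 / q) * Real.exp (-(x - m / q) ^ 2 / (2 * (v / q))) := by
    rw [← Real.exp_add, hexp, Real.exp_add]
  calc (√(2 * Real.pi * v))⁻¹ * Real.exp (-(x - m) ^ 2 / (2 * v)) * Real.exp (-c * x ^ 2)
      = (√(2 * Real.pi * v))⁻¹ * (Real.exp (-(x - m) ^ 2 / (2 * v)) * Real.exp (-c * x ^ 2)) := by
        ring
    _ = _ := by
      rw [e1]
      field_simp

theorem lintegral_exp_neg_sq_gaussianReal (m c : ℝ) {v : ℝ≥0} (hv : v ≠ 0)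
    (hc : 0 < 1 + 2 * c * v) :
    ∫⁻ x, ENNReal.ofReal (Real.exp (-c * x ^ 2)) ∂(gaussianReal m v) =
      ENNReal.ofReal ((√(1 + 2 * c * v))⁻¹ * Real.exp (-c * m ^ 2 / (1 + 2 * c * v))) := by
  have hv' : v / (1 + 2 * c * v).toNNReal ≠ 0 :=
    div_ne_zero hv (by simpa using hc)
  rw [gaussianReal_of_var_ne_zero _ hv, lintegral_withDensity_eq_lintegral_mul _
    (measurable_gaussianPDF m v) (by fun_prop)]
  have hpt : ∀ x, (gaussianPDF m v * fun x => ENNReal.ofReal (Real.exp (-c * x ^ 2))) x =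
      ENNReal.ofReal ((√(1 + 2 * c * v))⁻¹ * Real.exp (-c * m ^ 2 / (1 + 2 * c * v))) *
        gaussianPDF (m / (1 + 2 * c * v)) (v / (1 + 2 * c * v).toNNReal) x := by
    intro x
    rw [Pi.mul_apply, gaussianPDF, gaussianPDF,
      ← ENNReal.ofReal_mul (gaussianPDFReal_nonneg _ _ _), ← ENNReal.ofReal_mul (by positivity),
      gaussianPDFReal_mul_exp_neg_sq m c hv hc]
  rw [lintegral_congr hpt, lintegral_const_mul _ (measurable_gaussianPDF _ _),
    lintegral_gaussianPDF_eq_one _ hv', mul_one]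

theorem inv_sqrt_one_sub_two_mul_le {u : ℝ} (h0 : 0 ≤ u) (h1 : u ≤ 1 / 4) :
    (√(1 - 2 * u))⁻¹ ≤ Real.exp (u + 2 * u ^ 2) := by
  have hpos : 0 < 1 - 2 * u := by linarith
  have hexp : 1 + (2 * u + 4 * u ^ 2) + (2 * u + 4 * u ^ 2) ^ 2 / 2 ≤
      Real.exp (2 * u + 4 * u ^ 2) := Real.quadratic_le_exp_of_nonneg (by positivity)
  have hone : 1 ≤ (1 - 2 * u) * Real.exp (2 * u + 4 * u ^ 2) := by
    refine le_trans ?_ (mul_le_mul_of_nonneg_left hexp hpos.le)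
    have hfac : (1 - 2 * u) * (1 + (2 * u + 4 * u ^ 2) + (2 * u + 4 * u ^ 2) ^ 2 / 2) - 1 =
        2 * u ^ 2 * (1 - 2 * u - 4 * u ^ 2 - 8 * u ^ 3) := by ring
    have : 0 ≤ 1 - 2 * u - 4 * u ^ 2 - 8 * u ^ 3 := by
      have : u ^ 2 ≤ 1 / 16 := by nlinarith
      have : u ^ 3 ≤ 1 / 64 := by nlinarith
      linarith
    nlinarith [mul_nonneg (mul_nonneg zero_le_two (sq_nonneg u)) this]
  rw [inv_le_iff_one_le_mul₀ (Real.sqrt_pos.2 hpos), mul_comm]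
  have hsq : Real.exp (u + 2 * u ^ 2) = √(Real.exp (2 * u + 4 * u ^ 2)) := by
    rw [← Real.exp_half]
    ring_nf
  rw [hsq, ← Real.sqrt_mul hpos.le]
  exact Real.one_le_sqrt.2 hone

theorem inv_sqrt_one_add_two_mul_le {u : ℝ} (h0 : 0 ≤ u) :
    (√(1 + 2 * u))⁻¹ ≤ Real.exp (-u + u ^ 2) := by
  have hpos : 0 < 1 + 2 * u := by linarith
  have hlog := Real.le_log_one_add_of_nonneg (x := 2 * u) (by linarith)
  have hlog' : 2 * u - 2 * u ^ 2 ≤ Real.log (1 + 2 * u) := by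
    refine le_trans ?_ hlog
    rw [le_div_iff₀ (by linarith)]
    nlinarith [pow_nonneg h0 3]
  have hsq : (√(1 + 2 * u))⁻¹ = Real.exp (-(Real.log (1 + 2 * u) / 2)) := by
    rw [Real.exp_neg, Real.exp_half, Real.exp_log hpos]
  rw [hsq]
  exact Real.exp_le_exp.2 (by linarith)

/-- Exponential moment of a recentred squared centred Gaussian variable. -/
theorem lintegral_exp_sq_sub_var_le {t : ℝ} {v : ℝ≥0} (hv : v ≠ 0) (ht : 0 ≤ t)
    (htv : t * v ≤ 1 / 4) :
    ∫⁻ x, ENNReal.ofReal (Real.exp (t * (x ^ 2 - v))) ∂(gaussianReal 0 v) ≤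
      ENNReal.ofReal (Real.exp (2 * (t * v) ^ 2)) := by
  have hc : 0 < 1 + 2 * (-t) * (v : ℝ) := by linarith
  have hpt : ∀ x : ℝ, ENNReal.ofReal (Real.exp (t * (x ^ 2 - v))) =
      ENNReal.ofReal (Real.exp (-(t * v))) * ENNReal.ofReal (Real.exp (-(-t) * x ^ 2)) := by
    intro x
    rw [← ENNReal.ofReal_mul (Real.exp_nonneg _), ← Real.exp_add]
    ring_nf
  rw [lintegral_congr hpt, lintegral_const_mul _ (by fun_prop),
    lintegral_exp_neg_sq_gaussianReal 0 (-t) hv hc, ← ENNReal.ofReal_mul (Real.exp_nonneg _)]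
  refine ENNReal.ofReal_le_ofReal ?_
  have h := inv_sqrt_one_sub_two_mul_le (mul_nonneg ht v.coe_nonneg) htv
  have h2 : Real.exp (2 * (t * v) ^ 2) =
      Real.exp (-(t * v)) * Real.exp (t * v + 2 * (t * v) ^ 2) := by
    rw [← Real.exp_add]
    ring_nf
  rw [h2]
  refine mul_le_mul_of_nonneg_left ?_ (Real.exp_nonneg _)
  simpa [sub_eq_add_neg, mul_assoc] using h

/-- Negative exponential moment of a recentred squared Gaussian variable. -/
theorem lintegral_exp_neg_sq_sub_var_le (m : ℝ) {t : ℝ} {v : ℝ≥0} (hv : v ≠ 0) (ht : 0 ≤ t)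
    (htv : t * v ≤ 1 / 4) :
    ∫⁻ x, ENNReal.ofReal (Real.exp (-(t * (x ^ 2 - v)))) ∂(gaussianReal m v) ≤
      ENNReal.ofReal (Real.exp ((t * v) ^ 2 - 2 / 3 * (t * m ^ 2))) := by
  have htv0 : 0 ≤ t * v := mul_nonneg ht v.coe_nonneg
  have hc : 0 < 1 + 2 * t * (v : ℝ) := by linarith
  have hpt : ∀ x : ℝ, ENNReal.ofReal (Real.exp (-(t * (x ^ 2 - v)))) =
      ENNReal.ofReal (Real.exp (t * v)) * ENNReal.ofReal (Real.exp (-t * x ^ 2)) := by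
    intro x
    rw [← ENNReal.ofReal_mul (Real.exp_nonneg _), ← Real.exp_add]
    ring_nf
  rw [lintegral_congr hpt, lintegral_const_mul _ (by fun_prop),
    lintegral_exp_neg_sq_gaussianReal m t hv hc, ← ENNReal.ofReal_mul (Real.exp_nonneg _)]
  refine ENNReal.ofReal_le_ofReal ?_
  have h := inv_sqrt_one_add_two_mul_le htv0
  rw [← mul_assoc] at h
  have h2 : Real.exp ((t * v) ^ 2 - 2 / 3 * (t * m ^ 2)) =
      Real.exp (t * v) * (Real.exp (-(t * v) + (t * v) ^ 2) *
        Real.exp (-(2 / 3 * (t * m ^ 2)))) := by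
    rw [← Real.exp_add, ← Real.exp_add]
    ring_nf
  rw [h2]
  refine mul_le_mul_of_nonneg_left (mul_le_mul h (Real.exp_le_exp.2 ?_) (Real.exp_nonneg _)
    (Real.exp_nonneg _)) (Real.exp_nonneg _)
  -- The factor `2/3` is `1 / (1 + 2 · 1/4)`, the worst case allowed by `t v ≤ 1/4`.
  rw [neg_mul, neg_div, neg_le_neg_iff, le_div_iff₀ hc]
  have : 0 ≤ t * m ^ 2 := mul_nonneg ht (sq_nonneg m)
  nlinarith

/-- The likelihood ratio of `N(m + d, v)` with respect to `N(m, v)`. -/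
noncomputable def shiftDensity (m d v x : ℝ) : ℝ := Real.exp (d * (x - m) / v - d ^ 2 / (2 * v))

@[fun_prop]
theorem measurable_shiftDensity (m d v : ℝ) : Measurable (shiftDensity m d v) := by
  unfold shiftDensity
  fun_prop

theorem shiftDensity_nonneg (m d v x : ℝ) : 0 ≤ shiftDensity m d v x := Real.exp_nonneg _

theorem gaussianReal_add_eq_withDensity (m d : ℝ) {v : ℝ≥0} (hv : v ≠ 0) :
    gaussianReal (m + d) v =
      (gaussianReal m v).withDensity fun x => ENNReal.ofReal (shiftDensity m d v x) := by
  have hv' : (v : ℝ) ≠ 0 := by exact_mod_cast hv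
  rw [gaussianReal_of_var_ne_zero _ hv, gaussianReal_of_var_ne_zero _ hv,
    ← withDensity_mul _ (measurable_gaussianPDF m v) (by fun_prop)]
  congr 1
  ext x
  rw [Pi.mul_apply, gaussianPDF, gaussianPDF,
    ← ENNReal.ofReal_mul (gaussianPDFReal_nonneg _ _ _), gaussianPDFReal_def, gaussianPDFReal_def,
    shiftDensity]
  beta_reduce
  rw [mul_assoc (√(2 * Real.pi * v))⁻¹, ← Real.exp_add]
  congr 3
  field_simp
  ring

/-- The product of two shifts is `exp (d d' / v)` times the likelihood ratio of the combined shift,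
whose integral is 1. -/
theorem lintegral_shiftDensity_mul (m d d' : ℝ) {v : ℝ≥0} (hv : v ≠ 0) :
    ∫⁻ x, ENNReal.ofReal (shiftDensity m d v x * shiftDensity m d' v x) ∂(gaussianReal m v) =
      ENNReal.ofReal (Real.exp (d * d' / v)) := by
  have hv' : (v : ℝ) ≠ 0 := by exact_mod_cast hv
  have hpt : ∀ x, ENNReal.ofReal (shiftDensity m d v x * shiftDensity m d' v x) =
      ENNReal.ofReal (Real.exp (d * d' / v)) *
        ENNReal.ofReal (shiftDensity m (d + d') v x) := by
    intro x
    rw [← ENNReal.ofReal_mul (Real.exp_nonneg _)]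
    simp only [shiftDensity]
    rw [← Real.exp_add, ← Real.exp_add]
    congr 2
    field_simp
    ring
  rw [lintegral_congr hpt, lintegral_const_mul _ (by fun_prop), ← setLIntegral_univ,
    ← withDensity_apply _ MeasurableSet.univ, ← gaussianReal_add_eq_withDensity m _ hv,
    measure_univ, mul_one]

/-- Expanding the square, equal signs give `exp x` and opposite signs `exp (-x)` with `x = d²/v`, so
the integral is `cosh x ≤ exp (x²/2)`. The symmetrization removes the first-order term in `x`. -/
theorem lintegral_average_shiftDensity_sq_le (m d : ℝ) {v : ℝ≥0} (hv : v ≠ 0) :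
    ∫⁻ x, ENNReal.ofReal (((shiftDensity m d v x + shiftDensity m (-d) v x) / 2) ^ 2)
        ∂(gaussianReal m v) ≤ ENNReal.ofReal (Real.exp ((d ^ 2 / v) ^ 2 / 2)) := by
  have hpt : ∀ x, ENNReal.ofReal (((shiftDensity m d v x + shiftDensity m (-d) v x) / 2) ^ 2) =
      ENNReal.ofReal (1 / 4) * (ENNReal.ofReal (shiftDensity m d v x * shiftDensity m d v x) +
        ENNReal.ofReal (shiftDensity m (-d) v x * shiftDensity m (-d) v x)) +
      ENNReal.ofReal (1 / 2) *
        ENNReal.ofReal (shiftDensity m d v x * shiftDensity m (-d) v x) := by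
    intro x
    have h1 := shiftDensity_nonneg m d v x
    have h2 := shiftDensity_nonneg m (-d) v x
    rw [← ENNReal.ofReal_add (by positivity) (by positivity), ← ENNReal.ofReal_mul (by norm_num),
      ← ENNReal.ofReal_mul (by norm_num), ← ENNReal.ofReal_add (by positivity) (by positivity)]
    congr 1
    ring
  rw [lintegral_congr hpt, lintegral_add_left (by fun_prop), lintegral_const_mul _ (by fun_prop),
    lintegral_const_mul _ (by fun_prop), lintegral_add_left (by fun_prop),
    lintegral_shiftDensity_mul m _ _ hv, lintegral_shiftDensity_mul m _ _ hv,
    lintegral_shiftDensity_mul m _ _ hv,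
    ← ENNReal.ofReal_add (by positivity) (by positivity), ← ENNReal.ofReal_mul (by norm_num),
    ← ENNReal.ofReal_mul (by norm_num), ← ENNReal.ofReal_add (by positivity) (by positivity)]
  refine ENNReal.ofReal_le_ofReal (le_trans (le_of_eq ?_) (Real.cosh_le_exp_half_sq (d ^ 2 / v)))
  rw [Real.cosh_eq]
  have e1 : d * d / (v : ℝ) = d ^ 2 / v := by ring
  have e2 : -d * -d / (v : ℝ) = d ^ 2 / v := by ring
  have e3 : d * -d / (v : ℝ) = -(d ^ 2 / v) := by ring
  rw [e1, e2, e3]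
  ring

theorem map_sub_mul_prod_gaussianReal (m₁ m₂ c : ℝ) (v₁ v₂ : ℝ≥0) :
    ((gaussianReal m₁ v₁).prod (gaussianReal m₂ v₂)).map (fun p => p.1 - c * p.2) =
      gaussianReal (m₁ - c * m₂) (v₁ + (c ^ 2).toNNReal * v₂) := by
  have hind : IndepFun (fun p : ℝ × ℝ => p.1) (fun p : ℝ × ℝ => -c * p.2)
      ((gaussianReal m₁ v₁).prod (gaussianReal m₂ v₂)) :=
    indepFun_prod (X := id) (Y := fun x => -c * x) measurable_id (by fun_prop)
  have h1 : ((gaussianReal m₁ v₁).prod (gaussianReal m₂ v₂)).map (fun p => p.1) =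
      gaussianReal m₁ v₁ := by simp
  have h2 : ((gaussianReal m₁ v₁).prod (gaussianReal m₂ v₂)).map (fun p => -c * p.2) =
      gaussianReal (-c * m₂) ((c ^ 2).toNNReal * v₂) := by
    have hs : ((gaussianReal m₁ v₁).prod (gaussianReal m₂ v₂)).map Prod.snd =
      gaussianReal m₂ v₂ := by simp
    have := gaussianReal_map_const_mul (μ := m₂) (v := v₂) (-c)
    rw [← hs, Measure.map_map (by fun_prop) (by fun_prop)] at this
    rw [Function.comp_def] at this
    rw [this]
    congr 2
    ext
    simp [Real.coe_toNNReal _ (sq_nonneg c)]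
  have := gaussianReal_add_gaussianReal_of_indepFun hind h1 h2
  rw [sub_eq_add_neg, ← neg_mul, ← this]
  congr 1
  ext p
  simp [sub_eq_add_neg]

end GaussianIntegrals

/-! ### Square-summable sequences with finite support -/

section Sequences

theorem summable_sq (θ : EllTwo) : Summable fun j => θ j ^ 2 := by
  have h := (lp.memℓp θ).summable (by norm_num)
  simpa using h

theorem norm_sq_eq_tsum (θ : EllTwo) : ‖θ‖ ^ 2 = ∑' j, θ j ^ 2 := by
  have h := lp.norm_rpow_eq_tsum (p := 2) (by norm_num) θ
  simpa using h

/-- The square-summable sequence that agrees with `δ` on `S` and vanishes elsewhere. -/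
noncomputable def truncate (S : Finset ℕ+) (δ : ℕ+ → ℝ) : EllTwo :=
  ⟨fun j => if j ∈ S then δ j else 0, memℓp_gen <|
    summable_of_ne_finset_zero (s := S) fun j hj => by simp [hj]⟩

theorem truncate_apply (S : Finset ℕ+) (δ : ℕ+ → ℝ) (j : ℕ+) :
    truncate S δ j = if j ∈ S then δ j else 0 := rfl

theorem norm_truncate_sq (S : Finset ℕ+) (δ : ℕ+ → ℝ) :
    ‖truncate S δ‖ ^ 2 = ∑ j ∈ S, δ j ^ 2 := by
  rw [norm_sq_eq_tsum, tsum_eq_sum (s := S) fun j hj => by simp [truncate_apply, hj]]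
  exact Finset.sum_congr rfl fun j hj => by simp [truncate_apply, hj]

theorem truncate_mem_ellipsoid {a : ℕ+ → ℝ} {S : Finset ℕ+} {δ : ℕ+ → ℝ}
    (h : ∑ j ∈ S, a j ^ 2 * δ j ^ 2 ≤ 1) : truncate S δ ∈ ellipsoid a := by
  have hz : ∀ j ∉ S, a j ^ 2 * truncate S δ j ^ 2 = 0 := fun j hj => by
    simp [truncate_apply, hj]
  refine ⟨summable_of_ne_finset_zero hz, ?_⟩
  rw [tsum_eq_sum hz]
  refine le_of_eq_of_le (Finset.sum_congr rfl fun j hj => ?_) h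
  simp [truncate_apply, hj]

theorem truncate_singleton_mem_benchmarks {a : ℕ+ → ℝ} (ha : ∀ j, 0 < a j) (D : ℕ+) :
    truncate {D} (fun j => (a j)⁻¹) ∈ benchmarks a := by
  refine ⟨truncate_mem_ellipsoid ?_, fun h => ?_⟩
  · have := (ha D).ne'
    rw [Finset.sum_singleton]
    field_simp
    exact le_rfl
  · have h' : truncate {D} (fun j => (a j)⁻¹) D = 0 := by rw [h]; rfl
    simp [truncate_apply, (ha D).ne'] at h'

end Sequences

/-! ### Lower bound: the testing inequality and the noise on the singular values -/

section LowerBound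

instance isProbabilityMeasure_law (ε σ : ℝ) (θ : EllTwo) (ν : ℕ+ → ℝ) :
    IsProbabilityMeasure (law ε σ θ ν) := by
  unfold law
  infer_instance

theorem one_sub_errors_le {Ω : Type*} [MeasurableSpace Ω]
    (P Q : Measure Ω) [IsProbabilityMeasure P] [IsProbabilityMeasure Q] (L : Ω → ℝ)
    (hL : Measurable L) (hL0 : ∀ z, 0 ≤ L z)
    (hQ : Q = P.withDensity fun z => ENNReal.ofReal (L z)) {η : ℝ} (hη : 0 < η)
    (hsq : ∫⁻ z, ENNReal.ofReal (L z ^ 2) ∂P ≤ ENNReal.ofReal (1 + 4 * η ^ 2))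
    (T : Ω → Bool) (hT : Measurable T) {α β : ℝ} (hα : 0 ≤ α) (hβ : 0 ≤ β)
    (hPα : P {z | T z = true} ≤ ENNReal.ofReal α)
    (hQβ : Q {z | T z = false} ≤ ENNReal.ofReal β) : 1 - α - β ≤ η := by
  have hA : MeasurableSet {z | T z = false} := hT (measurableSet_singleton false)
  have h := measureReal_sub_le_of_lintegral_sq_le P Q L hL hL0 hQ hη hsq hA
  have hc : {z | T z = true} = {z | T z = false}ᶜ := by
    ext z
    simp
  have h1 : P.real {z | T z = true} ≤ α := ENNReal.toReal_le_of_le_ofReal hα hPα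
  have h2 : Q.real {z | T z = false} ≤ β := ENNReal.toReal_le_of_le_ofReal hβ hQβ
  rw [hc, probReal_compl_eq_one_sub hA] at h1
  linarith

/-- Reduces a lower bound on the extended-real radius to one real inequality per test and per
radius; a negative `y` is harmless because its square root is 0. -/
theorem ofReal_le_minimaxRadius_sq {a : ℕ+ → ℝ} {B : Set (ℕ+ → ℝ)} {α β ε σ y : ℝ}
    (h : ∀ Ψ, IsLevelTest a B α ε σ Ψ → ∀ r, 0 < r →
      secondKind a B ε σ Ψ r ≤ ENNReal.ofReal β → y ≤ r ^ 2) :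
    ENNReal.ofReal y ≤ minimaxRadius a B α β ε σ ^ 2 := by
  have h1 : ENNReal.ofReal √y ≤ minimaxRadius a B α β ε σ := by
    refine le_iInf₂ fun Ψ hΨ => le_iInf₂ fun r hr => ENNReal.ofReal_le_ofReal ?_
    exact Real.sqrt_le_iff.2 ⟨hr.1.le, h Ψ hΨ r hr.1 hr.2⟩
  refine le_trans ?_ (pow_le_pow_left₀ zero_le h1 2)
  rw [← ENNReal.ofReal_pow (Real.sqrt_nonneg _)]
  rcases le_total 0 y with hy | hy
  · rw [Real.sq_sqrt hy]
  · rw [ENNReal.ofReal_of_nonpos hy]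
    exact zero_le

theorem law_le_of_secondKind_le {a : ℕ+ → ℝ} {B : Set (ℕ+ → ℝ)} {β ε σ r : ℝ} {Ψ : Procedure}
    (h : secondKind a B ε σ Ψ r ≤ ENNReal.ofReal β) {θ₀ θ : EllTwo} (hθ₀ : θ₀ ∈ benchmarks a)
    (hθ : θ - θ₀ ∈ alternatives a r) {ν : ℕ+ → ℝ} (hν : ν ∈ B) :
    law ε σ θ ν {z | Ψ θ₀ z = false} ≤ ENNReal.ofReal β := by
  refine le_trans ?_ h
  unfold secondKind
  refine le_trans ?_ (le_iSup₂ (f := fun (θ₀ : EllTwo) (_ : θ₀ ∈ benchmarks a) =>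
    ⨆ (θ : EllTwo) (_ : θ - θ₀ ∈ alternatives a r), ⨆ ν ∈ B,
      law ε σ θ ν {z | Ψ θ₀ z = false}) θ₀ hθ₀)
  refine le_trans ?_ (le_iSup₂ (f := fun (θ : EllTwo) (_ : θ - θ₀ ∈ alternatives a r) =>
    ⨆ ν ∈ B, law ε σ θ ν {z | Ψ θ₀ z = false}) θ hθ)
  exact le_iSup₂ (f := fun (ν : ℕ+ → ℝ) (_ : ν ∈ B) =>
    law ε σ θ ν {z | Ψ θ₀ z = false}) ν hν

theorem self_mem_operatorClass {b : ℕ+ → ℝ} (hb : ∀ j, 0 < b j) {C₀ C₁ : ℝ} (hC₀ : C₀ ≤ 1)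
    (hC₁ : 1 ≤ C₁) : b ∈ operatorClass C₀ C₁ b := fun j =>
  ⟨by nlinarith [hb j], by nlinarith [hb j]⟩

theorem update_mem_operatorClass {b : ℕ+ → ℝ} (hb : ∀ j, 0 < b j) {C₀ C₁ : ℝ} (hC₀ : C₀ ≤ 1)
    (hC₁ : 1 ≤ C₁) {D : ℕ+} {x : ℝ} (h₀ : C₀ * b D ≤ x) (h₁ : x ≤ C₁ * b D) :
    Function.update b D x ∈ operatorClass C₀ C₁ b := by
  intro j
  rcases eq_or_ne j D with rfl | hj
  · simpa using ⟨h₀, h₁⟩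
  · simpa [hj] using self_mem_operatorClass hb hC₀ hC₁ j

theorem toNNReal_sq_ne_zero {σ : ℝ} (hσ : 0 < σ) : (σ ^ 2).toNNReal ≠ 0 := by
  simpa using hσ.ne'

theorem coe_toNNReal_sq (σ : ℝ) : ((σ ^ 2).toNNReal : ℝ) = σ ^ 2 :=
  Real.coe_toNNReal _ (sq_nonneg σ)

/-- Moving a single singular value while keeping `ν θ` fixed changes only one coordinate of the
observations. -/
theorem law_eq_withDensity_of_shift {ε σ : ℝ} (hσ : 0 < σ) (a b : ℕ+ → ℝ) (D : ℕ+)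
    (hbD : b D ≠ 0) (κ : ℝ) :
    law ε σ (truncate {D} fun j => (a j)⁻¹ * ((b j + κ) / b j)) b =
      (law ε σ (truncate {D} fun j => (a j)⁻¹) (Function.update b D (b D + κ))).withDensity
        fun z => ENNReal.ofReal (shiftDensity (b D + κ) (-κ) (σ ^ 2) (z D).2) := by
  have hden := infinitePi_eq_withDensity
    (fun j : ℕ+ => (gaussianReal (Function.update b D (b D + κ) j *
        truncate {D} (fun j => (a j)⁻¹) j) (Real.toNNReal (ε ^ 2))).prod
      (gaussianReal (Function.update b D (b D + κ) j) (Real.toNNReal (σ ^ 2))))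
    (fun j : ℕ+ => (gaussianReal (b j *
        truncate {D} (fun j => (a j)⁻¹ * ((b j + κ) / b j)) j) (Real.toNNReal (ε ^ 2))).prod
      (gaussianReal (b j) (Real.toNNReal (σ ^ 2)))) {D}
    (fun _ p => ENNReal.ofReal (shiftDensity (b D + κ) (-κ) (σ ^ 2) p.2))
    (fun _ => by fun_prop) ?_ ?_
  · simp only [Finset.prod_singleton] at hden
    exact hden
  · intro j hj
    rw [Finset.mem_singleton] at hj
    subst hj
    simp only [truncate_apply, Finset.mem_singleton, if_true, Function.update_self]
    -- The mean of `Y_D` is the same under both hypotheses, so only `X_D` enters the likelihood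
    -- ratio.
    have hmean : b j * ((a j)⁻¹ * ((b j + κ) / b j)) = (b j + κ) * (a j)⁻¹ := by
      field_simp
    have hX := gaussianReal_add_eq_withDensity (b j + κ) (-κ) (toNNReal_sq_ne_zero hσ)
    rw [add_neg_cancel_right, coe_toNNReal_sq] at hX
    rw [hmean, hX, prod_withDensity_right (by fun_prop)]
  · intro j hj
    rw [Finset.mem_singleton] at hj
    simp [truncate_apply, hj]

theorem lintegral_shiftDensity_sq_law {ε σ : ℝ} (hσ : 0 < σ) (θ : EllTwo) (ν : ℕ+ → ℝ) (D : ℕ+)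
    (d : ℝ) :
    ∫⁻ z, ENNReal.ofReal (shiftDensity (ν D) d (σ ^ 2) (z D).2 ^ 2) ∂(law ε σ θ ν) =
      ENNReal.ofReal (Real.exp (d ^ 2 / σ ^ 2)) := by
  have h := lintegral_infinitePi_prod
    (fun j : ℕ+ => (gaussianReal (ν j * θ j) (Real.toNNReal (ε ^ 2))).prod
      (gaussianReal (ν j) (Real.toNNReal (σ ^ 2)))) {D}
    (fun _ p => ENNReal.ofReal (shiftDensity (ν D) d (σ ^ 2) p.2 ^ 2)) (fun _ => by fun_prop)
  simp only [Finset.prod_singleton] at h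
  rw [law, h]
  rw [measurePreserving_snd.lintegral_comp
    (f := fun x => ENNReal.ofReal (shiftDensity (ν D) d (σ ^ 2) x ^ 2)) (by fun_prop)]
  have h2 := lintegral_shiftDensity_mul (ν D) d d (toNNReal_sq_ne_zero hσ)
  rw [coe_toNNReal_sq] at h2
  simpa [sq] using h2

theorem bigC_pos {α β : ℝ} (h : α + β < 1) : 0 < bigC α β := by
  refine Real.log_pos ?_
  nlinarith [pow_pos (show 0 < 1 - α - β by linarith) 2]

/-- The argument of the logarithm is at most `5 < e²`. The bound keeps the shift below `σ/2` and
makes `C ≤ C²/16` impossible for positive `C`. -/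
theorem bigC_le_two {α β : ℝ} (hα : 0 < α) (hβ : 0 < β) (h : α + β < 1) : bigC α β ≤ 2 := by
  have hu : 1 + 4 * (1 - α - β) ^ 2 ≤ 5 := by nlinarith
  rw [bigC, Real.log_le_iff_le_exp (by positivity)]
  have h1 := Real.exp_one_gt_d9
  have h2 : Real.exp 2 = Real.exp 1 * Real.exp 1 := by rw [← Real.exp_add]; norm_num
  nlinarith

/-- The admissible indices need not form an initial segment, so `D ≤ M₂` only yields an admissible
index beyond `D`; the monotonicity of `b` later carries the information back to `D`. -/
theorem exists_mass_of_le_bandM₂ {α β C₀ C₁ σ : ℝ} {b : ℕ+ → ℝ} {D : ℕ+}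
    (h : ((D : ℕ) : ℕ∞) ≤ bandM₂ α β C₀ C₁ σ b) :
    ∃ D', D ≤ D' ∧ bigC α β * σ * (b D')⁻¹ ≤ 2 ∧
      1 / √(1 + 4 * (1 - α - β) ^ 2) ≤ gaussMass C₀ C₁ σ b D' := by
  by_contra hcon
  push Not at hcon
  have hle : bandM₂ α β C₀ C₁ σ b ≤ (((D : ℕ) - 1 : ℕ) : ℕ∞) := by
    refine iSup₂_le fun D' hD' => ?_
    have hlt : D' < D := by
      by_contra hge
      exact absurd hD'.2 (not_le.2 (hcon D' (not_lt.1 hge) hD'.1))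
    have : (D' : ℕ) < D := hlt
    exact_mod_cast Nat.le_sub_one_of_lt this
  have := h.trans hle
  have h' : (D : ℕ) ≤ (D : ℕ) - 1 := by exact_mod_cast this
  have := D.pos
  omega

theorem gaussMass_le {C₀ C₁ σ : ℝ} (hσ : 0 < σ) {b : ℕ+ → ℝ} {D : ℕ+} (h : C₀ * b D ≤ C₁ * b D) :
    gaussMass C₀ C₁ σ b D ≤ 1 / (σ * √(2 * Real.pi)) * (C₁ * b D - C₀ * b D) := by
  unfold gaussMass
  refine mul_le_mul_of_nonneg_left ?_ (by positivity)
  have hmono := intervalIntegral.integral_mono_on (μ := volume) h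
    (f := fun t => Real.exp (-(1 / (2 * σ ^ 2)) * (t - b D) ^ 2)) (g := fun _ => 1)
    (Continuous.intervalIntegrable (by fun_prop) _ _) intervalIntegrable_const
    (fun t _ => Real.exp_le_one_iff.2 (by
      rw [neg_mul, Left.neg_nonpos_iff]
      positivity))
  simpa using hmono

/-- The Gaussian density is at most `1/(σ √(2π))`, so the mass condition forces the window to have
length at least `σ √(2π) / √(1 + 4(1 - α - β)²) ≥ σ`, because `5 ≤ 2π`. A shift of at most `σ/2`
then fits on at least one side of `b_D`, which is why the sign of `κ` is left open. -/
theorem exists_shift_in_window {α β C₀ C₁ σ : ℝ} (hα : 0 < α) (hβ : 0 < β) (hαβ : α + β < 1)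
    (hC₀ : C₀ ≤ 1) (hC₁ : 1 ≤ C₁) (hσ : 0 < σ) {b : ℕ+ → ℝ} (hb : ∀ j, 0 < b j)
    (hanti : Antitone b) {D : ℕ+} (h : ((D : ℕ) : ℕ∞) ≤ bandM₂ α β C₀ C₁ σ b) :
    bigC α β * σ ≤ 2 * b D ∧ ∃ κ, |κ| = bigC α β / 4 * σ ∧ C₀ * b D ≤ b D + κ ∧
      b D + κ ≤ C₁ * b D := by
  obtain ⟨D', hDD', h1, h2⟩ := exists_mass_of_le_bandM₂ h
  have hbb : b D' ≤ b D := hanti hDD'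
  have hCpos := bigC_pos hαβ
  have hCle := bigC_le_two hα hβ hαβ
  have h1' : bigC α β * σ ≤ 2 * b D' := by
    rwa [← div_eq_mul_inv, div_le_iff₀ (hb D')] at h1
  refine ⟨by linarith, ?_⟩
  have hlen : σ ≤ C₁ * b D - C₀ * b D := by
    have hm := h2.trans (gaussMass_le hσ (by nlinarith [hb D']))
    set u := 1 + 4 * (1 - α - β) ^ 2 with hu
    have hu0 : 0 < √u := Real.sqrt_pos.2 (by positivity)
    have hu5 : √u ≤ √(2 * Real.pi) := Real.sqrt_le_sqrt (by nlinarith [Real.pi_gt_three])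
    have hp0 : 0 < √(2 * Real.pi) := Real.sqrt_pos.2 (by positivity)
    rw [one_div_mul_eq_div, div_le_div_iff₀ hu0 (by positivity), one_mul] at hm
    have hd : 0 ≤ C₁ * b D' - C₀ * b D' := by nlinarith [hb D']
    have hσ' : σ * √(2 * Real.pi) ≤ (C₁ * b D' - C₀ * b D') * √(2 * Real.pi) :=
      hm.trans (mul_le_mul_of_nonneg_left hu5 hd)
    have := le_of_mul_le_mul_right hσ' hp0
    nlinarith
  have habs : 0 ≤ bigC α β / 4 * σ := by positivity
  have hsmall : bigC α β / 4 * σ ≤ σ / 2 := by nlinarith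
  by_cases hup : b D + bigC α β / 4 * σ ≤ C₁ * b D
  · exact ⟨_, abs_of_nonneg habs, by nlinarith [hb D], hup⟩
  · refine ⟨-(bigC α β / 4 * σ), by rw [abs_neg, abs_of_nonneg habs], by linarith, ?_⟩
    nlinarith [hb D]

theorem lowerSigma_le_minimaxRadius_sq {α β C₀ C₁ : ℝ} (hα : 0 < α) (hβ : 0 < β)
    (hαβ : α + β < 1) (hC₀ : C₀ ≤ 1) (hC₁ : 1 ≤ C₁) {a b : ℕ+ → ℝ} (ha : ∀ j, 0 < a j)
    (hb : ∀ j, 0 < b j) (hanti : Antitone b) {ε σ : ℝ} (hσ : 0 < σ) :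
    lowerSigma a b α β C₀ C₁ σ ≤ minimaxRadius a (operatorClass C₀ C₁ b) α β ε σ ^ 2 := by
  refine iSup₂_le fun D hD => ofReal_le_minimaxRadius_sq fun Ψ hΨ r hr hsecond => ?_
  by_contra! hlt
  obtain ⟨hq, κ, hκ, hκ₀, hκ₁⟩ := exists_shift_in_window hα hβ hαβ hC₀ hC₁ hσ hb hanti hD
  have hCpos := bigC_pos hαβ
  have haD := ha D
  have hbD := hb D
  set θ₀ := truncate {D} fun j => (a j)⁻¹ with hθ₀
  set θ := truncate {D} fun j => (a j)⁻¹ * ((b j + κ) / b j) with hθ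
  have hκsq : κ ^ 2 = bigC α β ^ 2 / 16 * σ ^ 2 := by
    rw [← sq_abs, hκ]
    ring
  have hdiff : θ - θ₀ = truncate {D} fun j => (a j)⁻¹ * (κ / b j) := by
    ext j
    rw [lp.coeFn_sub, Pi.sub_apply, hθ, hθ₀, truncate_apply, truncate_apply, truncate_apply]
    have := (hb j).ne'
    split_ifs
    · field_simp
      ring
    · simp
  have hκb : κ ^ 2 ≤ b D ^ 2 := by
    rw [hκsq]
    have : (bigC α β * σ) ^ 2 ≤ (2 * b D) ^ 2 := pow_le_pow_left₀ (by positivity) hq 2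
    nlinarith [sq_nonneg (b D)]
  have halt : θ - θ₀ ∈ alternatives a r := by
    rw [hdiff]
    refine ⟨truncate_mem_ellipsoid ?_, ?_⟩
    · rw [Finset.sum_singleton]
      have : a D ^ 2 * ((a D)⁻¹ * (κ / b D)) ^ 2 = κ ^ 2 / b D ^ 2 := by field_simp
      rw [this]
      exact div_le_one_of_le₀ hκb (by positivity)
    · refine le_of_lt (lt_of_pow_lt_pow_left₀ 2 (norm_nonneg _) ?_)
      rw [norm_truncate_sq, Finset.sum_singleton]
      refine hlt.trans_eq ?_
      rw [mul_pow, div_pow, hκsq]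
      field_simp
  -- The perturbed singular values accompany the null hypothesis and `b` itself the alternative.
  have hν := update_mem_operatorClass hb hC₀ hC₁ hκ₀ hκ₁
  have hnull := hΨ.2 θ₀ (truncate_singleton_mem_benchmarks ha D) _ hν
  have hsec := law_le_of_secondKind_le hsecond (truncate_singleton_mem_benchmarks ha D) halt
    (self_mem_operatorClass hb hC₀ hC₁)
  have hexp : 0 < (Real.exp (bigC α β ^ 2 / 16) - 1) / 4 := by
    have : 1 < Real.exp (bigC α β ^ 2 / 16) := Real.one_lt_exp_iff.2 (by positivity)
    linarith
  have hL2 := lintegral_shiftDensity_sq_law (ε := ε) hσ θ₀ (Function.update b D (b D + κ)) D (-κ)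
  rw [Function.update_self] at hL2
  have hfinal := one_sub_errors_le (η := √((Real.exp (bigC α β ^ 2 / 16) - 1) / 4)) _ _
    (fun z : Obs => shiftDensity (b D + κ) (-κ) (σ ^ 2) (z D).2)
    (by fun_prop) (fun z => shiftDensity_nonneg _ _ _ _)
    (law_eq_withDensity_of_shift (ε := ε) hσ a b D hbD.ne' κ) (Real.sqrt_pos.2 hexp)
    (by
      rw [hL2, Real.sq_sqrt hexp.le, neg_sq, hκsq]
      refine ENNReal.ofReal_le_ofReal (le_of_eq ?_)
      rw [mul_div_assoc, div_self (by positivity), mul_one]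
      ring)
    (Ψ θ₀) (hΨ.1 θ₀) hα.le hβ.le hnull hsec
  have hsq : (1 - α - β) ^ 2 ≤ (Real.exp (bigC α β ^ 2 / 16) - 1) / 4 := by
    rw [← Real.sq_sqrt hexp.le]
    exact pow_le_pow_left₀ (by linarith) hfinal 2
  -- The chi-square divergence is `exp (κ²/σ²) - 1 = exp (C²/16) - 1`, so the testing inequality
  -- reads `C ≤ C²/16`, against `0 < C ≤ 2`.
  have hle : bigC α β ≤ bigC α β ^ 2 / 16 := by
    conv_lhs => rw [bigC]
    rw [Real.log_le_iff_le_exp (by positivity)]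
    linarith
  nlinarith [bigC_le_two hα hβ hαβ]

/-- If every choice of signs gives mass at most `c` to `A`, then so does the product of the
coordinatewise mixtures. -/
theorem infinitePi_average_le {ι Y : Type*} [DecidableEq ι] [MeasurableSpace Y]
    (p q : ι → Measure Y) [∀ i, IsProbabilityMeasure (p i)] [∀ i, IsProbabilityMeasure (q i)]
    (A : Set (ι → Y)) (c : ℝ≥0∞) (S : Finset ι) :
    ∀ (μ : ι → Measure Y) [∀ i, IsProbabilityMeasure (μ i)],
      (∀ e : ι → Bool, Measure.infinitePi
        (fun i => if i ∈ S then (if e i then p i else q i) else μ i) A ≤ c) →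
      Measure.infinitePi
        (fun i => if i ∈ S then (2⁻¹ : ℝ≥0∞) • (p i + q i) else μ i) A ≤ c := by
  have havg : ∀ i, IsProbabilityMeasure ((2⁻¹ : ℝ≥0∞) • (p i + q i)) := fun i => ⟨by
    rw [Measure.smul_apply, Measure.add_apply, measure_univ, measure_univ, smul_eq_mul,
      one_add_one_eq_two, ENNReal.inv_mul_cancel two_ne_zero ENNReal.ofNat_ne_top]⟩
  induction S using Finset.induction_on with
  | empty =>
    intro μ _ h
    simpa using h fun _ => true
  | insert k S hk ih =>
    intro μ _ h
    have hupd : ∀ m : Measure Y, (fun i => if i ∈ S then (2⁻¹ : ℝ≥0∞) • (p i + q i) else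
        Function.update μ k m i) = Function.update
          (fun i => if i ∈ S then (2⁻¹ : ℝ≥0∞) • (p i + q i) else μ i) k m := by
      intro m
      ext1 i
      rcases eq_or_ne i k with rfl | hi
      · simp [hk]
      · simp [hi]
    have hprobU : ∀ m : Measure Y, IsProbabilityMeasure m →
        ∀ i, IsProbabilityMeasure (Function.update μ k m i) := by
      intro m hm i
      rcases eq_or_ne i k with rfl | hi
      · simpa using hm
      · simp only [Function.update_of_ne hi]
        infer_instance
    have hprob : ∀ m : Measure Y, IsProbabilityMeasure m → ∀ i, IsProbabilityMeasure
        (if i ∈ S then (2⁻¹ : ℝ≥0∞) • (p i + q i) else Function.update μ k m i) := by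
      intro m hm i
      split_ifs
      · exact havg i
      · exact hprobU m hm i
    have hprob0 : ∀ i, IsProbabilityMeasure
        (if i ∈ S then (2⁻¹ : ℝ≥0∞) • (p i + q i) else μ i) := by
      intro i
      split_ifs
      · exact havg i
      · infer_instance
    have hmain : (fun i => if i ∈ insert k S then (2⁻¹ : ℝ≥0∞) • (p i + q i) else μ i) =
        fun i => if i ∈ S then (2⁻¹ : ℝ≥0∞) • (p i + q i) else
          Function.update μ k ((2⁻¹ : ℝ≥0∞) • (p k + q k)) i := by
      ext1 i
      rcases eq_or_ne i k with rfl | hi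
      · simp [hk]
      · simp [hi]
    have := hprob _ (havg k)
    have := hprob (p k) inferInstance
    have := hprob (q k) inferInstance
    have hside : ∀ (m : Measure Y) (t : Bool), IsProbabilityMeasure m →
        m = (if t then p k else q k) →
        Measure.infinitePi (fun i => if i ∈ S then (2⁻¹ : ℝ≥0∞) • (p i + q i) else
          Function.update μ k m i) A ≤ c := by
      intro m t hm hmt
      have := hprobU m hm
      -- The induction keeps the background `μ` general so that coordinate `k`, once fixed to one
      -- component, joins it; the sign pattern is overridden at `k` accordingly.
      refine ih (Function.update μ k m) fun e => ?_
      refine le_of_eq_of_le ?_ (h (Function.update e k t))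
      congr 2
      ext1 i
      rcases eq_or_ne i k with rfl | hi
      · simp [hk, hmt]
      · simp [hi]
    rw [hmain, infinitePi_update_average _ k (p k) (q k) _ _ _ (hupd _) (hupd (p k)) (hupd (q k)),
      Measure.smul_apply, Measure.add_apply, smul_eq_mul]
    calc _ ≤ (2⁻¹ : ℝ≥0∞) * (c + c) := by
          gcongr
          · exact hside (p k) true inferInstance rfl
          · exact hside (q k) false inferInstance rfl
      _ = c := by
        rw [← two_mul, ← mul_assoc, ENNReal.inv_mul_cancel two_ne_zero ENNReal.ofNat_ne_top,
          one_mul]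

end LowerBound

/-! ### Lower bound: the noise on the signal, by random signs -/

section SignMixture

theorem average_prod_eq_withDensity (m d : ℝ) {v : ℝ≥0} (hv : v ≠ 0) (R : Measure ℝ) [SFinite R] :
    (2⁻¹ : ℝ≥0∞) • ((gaussianReal (m + d) v).prod R + (gaussianReal (m + -d) v).prod R) =
      ((gaussianReal m v).prod R).withDensity fun p =>
        ENNReal.ofReal ((shiftDensity m d v p.1 + shiftDensity m (-d) v p.1) / 2) := by
  rw [gaussianReal_add_eq_withDensity m d hv, gaussianReal_add_eq_withDensity m (-d) hv,
    prod_withDensity_left (by fun_prop), prod_withDensity_left (by fun_prop),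
    ← withDensity_add_left (by fun_prop), ← withDensity_smul _ (by fun_prop)]
  congr 1
  ext p
  simp only [Pi.smul_apply, Pi.add_apply, smul_eq_mul]
  rw [← ENNReal.ofReal_add (shiftDensity_nonneg _ _ _ _) (shiftDensity_nonneg _ _ _ _),
    div_eq_inv_mul, ENNReal.ofReal_mul (by norm_num), ENNReal.ofReal_inv_of_pos two_pos,
    ENNReal.ofReal_ofNat]

/-- A test with small errors at `θ₀` and at all sign-perturbations of `θ₀` forces the perturbation
to be large. -/
theorem one_sub_errors_le_of_signs {ε σ : ℝ} (hε : 0 < ε) (θ₀ : EllTwo) (b δ : ℕ+ → ℝ)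
    (S : Finset ℕ+) {α β η : ℝ} (hα : 0 ≤ α) (hβ : 0 ≤ β) (hη : 0 < η)
    (hsum : Real.exp ((∑ j ∈ S, ((b j * δ j) ^ 2 / ε ^ 2) ^ 2) / 2) ≤ 1 + 4 * η ^ 2)
    (T : Obs → Bool) (hT : Measurable T)
    (h₀ : law ε σ θ₀ b {z | T z = true} ≤ ENNReal.ofReal α)
    (h₁ : ∀ e : ℕ+ → Bool,
      law ε σ (θ₀ + truncate S fun j => (if e j then 1 else -1) * δ j) b {z | T z = false} ≤
        ENNReal.ofReal β) :
    1 - α - β ≤ η := by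
  set v := (ε ^ 2).toNNReal with hv
  have hv0 : v ≠ 0 := toNNReal_sq_ne_zero hε
  have hvε : (v : ℝ) = ε ^ 2 := coe_toNNReal_sq ε
  let R : ℕ+ → Measure ℝ := fun j => gaussianReal (b j) (σ ^ 2).toNNReal
  let μ : ℕ+ → Measure (ℝ × ℝ) := fun j => (gaussianReal (b j * θ₀ j) v).prod (R j)
  let p : ℕ+ → Measure (ℝ × ℝ) := fun j =>
    (gaussianReal (b j * θ₀ j + b j * δ j) v).prod (R j)
  let q : ℕ+ → Measure (ℝ × ℝ) := fun j =>
    (gaussianReal (b j * θ₀ j + -(b j * δ j)) v).prod (R j)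
  have hμP : ∀ j, IsProbabilityMeasure (μ j) := fun j => by simp only [μ, R]; infer_instance
  have hpP : ∀ j, IsProbabilityMeasure (p j) := fun j => by simp only [p, R]; infer_instance
  have hqP : ∀ j, IsProbabilityMeasure (q j) := fun j => by simp only [q, R]; infer_instance
  let l : ℕ+ → ℝ → ℝ := fun j x => (shiftDensity (b j * θ₀ j) (b j * δ j) v x +
    shiftDensity (b j * θ₀ j) (-(b j * δ j)) v x) / 2
  have hl : ∀ j, Measurable (l j) := fun j => by fun_prop
  have hl0 : ∀ j x, 0 ≤ l j x := fun j x =>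
    div_nonneg (add_nonneg (shiftDensity_nonneg _ _ _ _) (shiftDensity_nonneg _ _ _ _)) two_pos.le
  let μ' : ℕ+ → Measure (ℝ × ℝ) := fun j =>
    if j ∈ S then (2⁻¹ : ℝ≥0∞) • (p j + q j) else μ j
  have hμ'P : ∀ j, IsProbabilityMeasure (μ' j) := by
    intro j
    simp only [μ']
    split_ifs
    · exact ⟨by
        rw [Measure.smul_apply, Measure.add_apply, measure_univ, measure_univ, smul_eq_mul,
          one_add_one_eq_two, ENNReal.inv_mul_cancel two_ne_zero ENNReal.ofNat_ne_top]⟩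
    · exact hμP j
  have hden : Measure.infinitePi μ' = (Measure.infinitePi μ).withDensity fun z =>
      ENNReal.ofReal (∏ j ∈ S, l j (z j).1) := by
    have h := infinitePi_eq_withDensity μ μ' S (fun j x => ENNReal.ofReal (l j x.1))
      (fun j => by fun_prop)
      (fun j hj => by
        simp only [μ', hj, if_true]
        exact average_prod_eq_withDensity _ _ hv0 (R j))
      (fun j hj => by simp only [μ', hj, if_false])
    rw [h]
    congr 1
    ext z
    rw [ENNReal.ofReal_prod_of_nonneg fun j _ => hl0 j _]
  have hsq : ∫⁻ z, ENNReal.ofReal ((∏ j ∈ S, l j (z j).1) ^ 2) ∂(Measure.infinitePi μ) ≤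
      ENNReal.ofReal (1 + 4 * η ^ 2) := by
    have hpt : ∀ z : Obs, ENNReal.ofReal ((∏ j ∈ S, l j (z j).1) ^ 2) =
        ∏ j ∈ S, ENNReal.ofReal (l j (z j).1 ^ 2) := by
      intro z
      rw [← Finset.prod_pow, ENNReal.ofReal_prod_of_nonneg fun j _ => sq_nonneg _]
    rw [lintegral_congr hpt, lintegral_infinitePi_prod μ S
      (fun j x => ENNReal.ofReal (l j x.1 ^ 2)) fun j => by fun_prop]
    calc _ ≤ ∏ j ∈ S, ENNReal.ofReal (Real.exp (((b j * δ j) ^ 2 / ε ^ 2) ^ 2 / 2)) := by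
          refine Finset.prod_le_prod' fun j _ => ?_
          rw [measurePreserving_fst.lintegral_comp
            (f := fun x => ENNReal.ofReal (l j x ^ 2)) (by fun_prop), ← hvε]
          exact lintegral_average_shiftDensity_sq_le _ _ hv0
      _ = ENNReal.ofReal (Real.exp ((∑ j ∈ S, ((b j * δ j) ^ 2 / ε ^ 2) ^ 2) / 2)) := by
          rw [← ENNReal.ofReal_prod_of_nonneg fun j _ => Real.exp_nonneg _, ← Real.exp_sum,
            Finset.sum_div]
      _ ≤ _ := ENNReal.ofReal_le_ofReal hsum
  have hmix : Measure.infinitePi μ' {z | T z = false} ≤ ENNReal.ofReal β := by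
    refine infinitePi_average_le p q _ _ S μ fun e => ?_
    refine le_of_eq_of_le ?_ (h₁ e)
    unfold law
    congr 2
    ext1 j
    rw [lp.coeFn_add, Pi.add_apply, truncate_apply]
    by_cases hj : j ∈ S
    · rcases he : e j
      · simp [hj, q, R, mul_add, v]
      · simp [hj, p, R, mul_add, v]
    · simp [hj, μ, R, v]
  exact one_sub_errors_le (Measure.infinitePi μ) (Measure.infinitePi μ')
    (fun z => ∏ j ∈ S, l j (z j).1)
    (Finset.measurable_prod _ fun j _ => (hl j).comp (measurable_pi_apply j).fst)
    (fun z => Finset.prod_nonneg fun j _ => hl0 j _) hden hη hsq T hT hα hβ h₀ hmix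

theorem lowerEps_le_minimaxRadius_sq {α β C₀ C₁ : ℝ} (hα : 0 < α) (hβ : 0 < β)
    (hαβ : α + β < 1) (hC₀ : C₀ ≤ 1) (hC₁ : 1 ≤ C₁) {a b : ℕ+ → ℝ} (ha : ∀ j, 0 < a j)
    (ha_mono : Monotone a) (hb : ∀ j, 0 < b j) {ε σ : ℝ} (hε : 0 < ε) :
    lowerEps a b α β ε ≤ minimaxRadius a (operatorClass C₀ C₁ b) α β ε σ ^ 2 := by
  refine iSup_le fun D => ofReal_le_minimaxRadius_sq fun Ψ hΨ r hr hsecond => ?_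
  by_contra! hlt
  obtain ⟨hlt₁, hlt₂⟩ := lt_min_iff.1 hlt
  set S := Finset.Icc 1 D with hS
  set s := ∑ j ∈ S, (b j ^ 4)⁻¹ with hs
  have hs0 : 0 < s := Finset.sum_pos (fun j _ => by have := hb j; positivity)
    ⟨1, Finset.mem_Icc.2 ⟨le_rfl, one_le⟩⟩
  have hsq0 : 0 < √s := Real.sqrt_pos.2 hs0
  -- Least favourable amplitudes: for fixed `∑ δ_j² = r²`, Cauchy–Schwarz shows that `∑ (b_j δ_j)⁴`
  -- is smallest when `δ_j² ∝ b_j⁻⁴`.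
  let δ : ℕ+ → ℝ := fun j => r * (b j ^ 2)⁻¹ / √s
  have hδsq : ∀ j, δ j ^ 2 = r ^ 2 / s * (b j ^ 4)⁻¹ := by
    intro j
    simp only [δ]
    rw [div_pow, Real.sq_sqrt hs0.le]
    ring
  have hnorm : ∑ j ∈ S, δ j ^ 2 = r ^ 2 := by
    simp only [hδsq]
    rw [← Finset.mul_sum, ← hs]
    field_simp
  have hbδ : ∀ j, ((b j * δ j) ^ 2 / ε ^ 2) ^ 2 = (r ^ 2 / (s * ε ^ 2)) ^ 2 * (b j ^ 4)⁻¹ := by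
    intro j
    have := (hb j).ne'
    rw [mul_pow, hδsq]
    field_simp
  have hchi : (∑ j ∈ S, ((b j * δ j) ^ 2 / ε ^ 2) ^ 2) = r ^ 4 / (s * ε ^ 4) := by
    simp only [hbδ]
    rw [← Finset.mul_sum, ← hs]
    field_simp
  set x := r ^ 4 / (s * ε ^ 4) / 2 with hx
  have hx0 : 0 < x := by positivity
  have hexp : 0 < (Real.exp x - 1) / 4 := by
    have := Real.one_lt_exp_iff.2 hx0
    linarith
  -- Any benchmark would do, since the chi-square bound depends only on the perturbation.
  have hθ₀ := truncate_singleton_mem_benchmarks ha 1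
  set θ₀ := truncate {1} fun j => (a j)⁻¹
  have hB := self_mem_operatorClass hb hC₀ hC₁
  have hfinal := one_sub_errors_le_of_signs (σ := σ) (η := √((Real.exp x - 1) / 4)) hε θ₀ b δ S
    hα.le hβ.le (Real.sqrt_pos.2 hexp)
    (by
      rw [hchi, Real.sq_sqrt hexp.le]
      linarith)
    (Ψ θ₀) (hΨ.1 θ₀) (hΨ.2 θ₀ hθ₀ b hB)
    (fun e => law_le_of_secondKind_le hsecond hθ₀
      (by
        rw [add_sub_cancel_left]
        have he : ∀ j, ((if e j then (1 : ℝ) else -1) * δ j) ^ 2 = δ j ^ 2 := by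
          intro j
          split_ifs <;> ring
        refine ⟨truncate_mem_ellipsoid ?_, ?_⟩
        · calc ∑ j ∈ S, a j ^ 2 * ((if e j then (1 : ℝ) else -1) * δ j) ^ 2
              ≤ ∑ j ∈ S, a D ^ 2 * δ j ^ 2 := by
                refine Finset.sum_le_sum fun j hj => ?_
                rw [he]
                refine mul_le_mul_of_nonneg_right ?_ (sq_nonneg _)
                exact pow_le_pow_left₀ (ha j).le (ha_mono (Finset.mem_Icc.1 hj).2) 2
            _ = a D ^ 2 * r ^ 2 := by rw [← Finset.mul_sum, hnorm]
            _ ≤ 1 := by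
              have hpos : 0 < a D ^ 2 := pow_pos (ha D) 2
              calc a D ^ 2 * r ^ 2 ≤ a D ^ 2 * (a D ^ 2)⁻¹ :=
                    mul_le_mul_of_nonneg_left hlt₂.le hpos.le
                _ = 1 := mul_inv_cancel₀ hpos.ne'
        · refine le_of_eq ?_
          rw [← Real.sqrt_sq (norm_nonneg _), norm_truncate_sq]
          simp only [he]
          rw [hnorm, Real.sqrt_sq hr.le])
      hB)
  have hsq : (1 - α - β) ^ 2 ≤ (Real.exp x - 1) / 4 := by
    rw [← Real.sq_sqrt hexp.le]
    exact pow_le_pow_left₀ (by linarith) hfinal 2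
  have hlog : bigC α β ≤ x := by
    rw [bigC, Real.log_le_iff_le_exp (by positivity)]
    linarith
  have hlt₁' : r ^ 4 < 2 * bigC α β * ε ^ 4 * s := by
    have h4 : (r ^ 2) ^ 2 < (smallC α β * ε ^ 2 * √s) ^ 2 :=
      pow_lt_pow_left₀ hlt₁ (by positivity) two_ne_zero
    have hc : smallC α β ^ 2 = 2 * bigC α β := by
      rw [smallC]
      exact Real.sq_sqrt (mul_nonneg two_pos.le (bigC_pos hαβ).le)
    rw [mul_pow, mul_pow, hc, Real.sq_sqrt hs0.le] at h4
    nlinarith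
  rw [hx, le_div_iff₀ two_pos, le_div_iff₀ (by positivity)] at hlog
  nlinarith

end SignMixture

/-! ### Deviations of the weighted chi-square statistic -/

section Statistic

theorem measure_nonneg_le_lintegral_exp {Ω : Type*} [MeasurableSpace Ω] (P : Measure Ω)
    {g : Ω → ℝ} (hg : Measurable g) :
    P {z | 0 ≤ g z} ≤ ∫⁻ z, ENNReal.ofReal (Real.exp (g z)) ∂P := by
  have h := mul_meas_ge_le_lintegral (μ := P)
    (f := fun z => ENNReal.ofReal (Real.exp (g z))) (by fun_prop) 1
  rw [one_mul] at h
  refine le_trans (measure_mono fun z hz => ?_) h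
  simpa using hz

theorem lintegral_exp_sum_infinitePi {ι : Type*} {X : ι → Type*} [∀ i, MeasurableSpace (X i)]
    (μ : ∀ i, Measure (X i)) [∀ i, IsProbabilityMeasure (μ i)] (S : Finset ι)
    (g : ∀ i, X i → ℝ) (hg : ∀ i, Measurable (g i)) (c : ℝ) :
    ∫⁻ z, ENNReal.ofReal (Real.exp (∑ i ∈ S, g i (z i) + c)) ∂(Measure.infinitePi μ) =
      (∏ i ∈ S, ∫⁻ x, ENNReal.ofReal (Real.exp (g i x)) ∂(μ i)) *
        ENNReal.ofReal (Real.exp c) := by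
  have hpt : ∀ z : ∀ i, X i, ENNReal.ofReal (Real.exp (∑ i ∈ S, g i (z i) + c)) =
      (∏ i ∈ S, ENNReal.ofReal (Real.exp (g i (z i)))) * ENNReal.ofReal (Real.exp c) := by
    intro z
    rw [Real.exp_add, Real.exp_sum, ENNReal.ofReal_mul (Finset.prod_nonneg fun _ _ =>
      Real.exp_nonneg _), ENNReal.ofReal_prod_of_nonneg fun _ _ => Real.exp_nonneg _]
  rw [lintegral_congr hpt, lintegral_mul_const' _ _ ENNReal.ofReal_ne_top,
    lintegral_infinitePi_prod μ S (fun i x => ENNReal.ofReal (Real.exp (g i x)))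
      fun i => by have := hg i; fun_prop]

variable {Y : Type*} [MeasurableSpace Y]

/-- The weighted, recentred chi-square statistic. -/
def chiSquareStat (S : Finset ℕ+) (t : ℕ+ → ℝ) (v : ℕ+ → ℝ≥0) (ζ : ℕ+ → Y → ℝ) (z : ℕ+ → Y) : ℝ :=
  ∑ j ∈ S, t j * (ζ j (z j) ^ 2 - v j)

theorem measurable_chiSquareStat (S : Finset ℕ+) (t : ℕ+ → ℝ) (v : ℕ+ → ℝ≥0) {ζ : ℕ+ → Y → ℝ}
    (hζ : ∀ j, Measurable (ζ j)) : Measurable (chiSquareStat S t v ζ) := by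
  unfold chiSquareStat
  refine Finset.measurable_fun_sum _ fun j _ => ?_
  have := (hζ j).comp (measurable_pi_apply (X := fun _ : ℕ+ => Y) j)
  simp only [Function.comp_def] at this
  fun_prop

variable {S : Finset ℕ+} {t : ℕ+ → ℝ} {v : ℕ+ → ℝ≥0} {ζ : ℕ+ → Y → ℝ}

/-- The normalization `1/16` is chosen so that each weight meets the condition `t v ≤ 1/4` of the
exponential moment bounds. -/
theorem weight_mul_var_le (hsum : ∑ j ∈ S, (t j * v j) ^ 2 ≤ 1 / 16)
    {j : ℕ+} (hj : j ∈ S) : t j * v j ≤ 1 / 4 := by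
  have h := (Finset.single_le_sum (f := fun j => (t j * v j : ℝ) ^ 2)
    (fun i _ => sq_nonneg _) hj).trans hsum
  refine le_of_sq_le_sq ?_ (by norm_num)
  norm_num
  norm_num at h
  exact h

/-- Markov's inequality for `exp T`, with the exponential parameter already contained in the
weights. The `1/8` pays for `2 ∑ (t_j v_j)²`. -/
theorem measure_chiSquareStat_ge_le (hζ : ∀ j, Measurable (ζ j)) (hv : ∀ j, v j ≠ 0)
    (ht : ∀ j, 0 ≤ t j) (hsum : ∑ j ∈ S, (t j * v j) ^ 2 ≤ 1 / 16)
    (μ : ℕ+ → Measure Y) [∀ j, IsProbabilityMeasure (μ j)]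
    (hμ : ∀ j, (μ j).map (ζ j) = gaussianReal 0 (v j)) (x : ℝ) :
    Measure.infinitePi μ {z | x + 1 / 8 ≤ chiSquareStat S t v ζ z} ≤
      ENNReal.ofReal (Real.exp (-x)) := by
  have hmeas := measurable_chiSquareStat S t v hζ
  have h := measure_nonneg_le_lintegral_exp (Measure.infinitePi μ)
    (g := fun z => chiSquareStat S t v ζ z + -(x + 1 / 8)) (by fun_prop)
  have hset : {z | x + 1 / 8 ≤ chiSquareStat S t v ζ z} =
      {z | 0 ≤ chiSquareStat S t v ζ z + -(x + 1 / 8)} := by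
    ext z
    simp only [Set.mem_ofPred_eq]
    constructor <;> intro h <;> linarith
  rw [hset]
  refine h.trans ?_
  unfold chiSquareStat
  rw [lintegral_exp_sum_infinitePi μ S (fun j y => t j * (ζ j y ^ 2 - v j))
    (fun j => by have := hζ j; fun_prop)]
  calc _ ≤ (∏ j ∈ S, ENNReal.ofReal (Real.exp (2 * (t j * v j) ^ 2))) *
        ENNReal.ofReal (Real.exp (-(x + 1 / 8))) := by
        gcongr with j hj
        rw [← lintegral_map (f := fun y => ENNReal.ofReal (Real.exp (t j * (y ^ 2 - v j))))
          (by fun_prop) (hζ j), hμ j]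
        exact lintegral_exp_sq_sub_var_le (hv j) (ht j) (weight_mul_var_le hsum hj)
    _ = ENNReal.ofReal (Real.exp (2 * ∑ j ∈ S, (t j * v j) ^ 2 + -(x + 1 / 8))) := by
        rw [← ENNReal.ofReal_prod_of_nonneg fun _ _ => Real.exp_nonneg _, ← Real.exp_sum,
          ← ENNReal.ofReal_mul (Real.exp_nonneg _), ← Real.exp_add, Finset.mul_sum]
    _ ≤ _ := ENNReal.ofReal_le_ofReal (Real.exp_le_exp.2 (by linarith))

/-- Markov's inequality for `exp (-T)`. The signal enters the exponent linearly and needs no upper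
bound, and no variance term caused by the signal appears. -/
theorem measure_chiSquareStat_lt_le (hζ : ∀ j, Measurable (ζ j)) (hv : ∀ j, v j ≠ 0)
    (ht : ∀ j, 0 ≤ t j) (hsum : ∑ j ∈ S, (t j * v j) ^ 2 ≤ 1 / 16)
    (μ : ℕ+ → Measure Y) [∀ j, IsProbabilityMeasure (μ j)] (m : ℕ+ → ℝ)
    (hμ : ∀ j, (μ j).map (ζ j) = gaussianReal (m j) (v j)) (x : ℝ) :
    Measure.infinitePi μ {z | chiSquareStat S t v ζ z < x} ≤
      ENNReal.ofReal (Real.exp (x + 1 / 16 - 2 / 3 * ∑ j ∈ S, t j * m j ^ 2)) := by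
  have hmeas := measurable_chiSquareStat S t v hζ
  have h := measure_nonneg_le_lintegral_exp (Measure.infinitePi μ)
    (g := fun z => -chiSquareStat S t v ζ z + x) (by fun_prop)
  refine (measure_mono fun z hz => ?_).trans (h.trans ?_)
  · simp only [Set.mem_ofPred_eq] at hz ⊢
    linarith
  unfold chiSquareStat
  simp only [← Finset.sum_neg_distrib]
  rw [lintegral_exp_sum_infinitePi μ S (fun j y => -(t j * (ζ j y ^ 2 - v j)))
    (fun j => by have := hζ j; fun_prop)]
  calc _ ≤ (∏ j ∈ S, ENNReal.ofReal (Real.exp ((t j * v j) ^ 2 - 2 / 3 * (t j * m j ^ 2)))) *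
        ENNReal.ofReal (Real.exp x) := by
        gcongr with j hj
        rw [← lintegral_map (f := fun y => ENNReal.ofReal (Real.exp (-(t j * (y ^ 2 - v j)))))
          (by fun_prop) (hζ j), hμ j]
        exact lintegral_exp_neg_sq_sub_var_le (m j) (hv j) (ht j) (weight_mul_var_le hsum hj)
    _ = ENNReal.ofReal (Real.exp (∑ j ∈ S, (t j * v j) ^ 2 -
          2 / 3 * ∑ j ∈ S, t j * m j ^ 2 + x)) := by
        rw [← ENNReal.ofReal_prod_of_nonneg fun _ _ => Real.exp_nonneg _, ← Real.exp_sum,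
          ← ENNReal.ofReal_mul (Real.exp_nonneg _), ← Real.exp_add, Finset.sum_sub_distrib,
          Finset.mul_sum]
    _ ≤ _ := ENNReal.ofReal_le_ofReal (Real.exp_le_exp.2 (by linarith))

end Statistic

/-! ### Separation radius of the chi-square test -/

section UpperBound

theorem norm_sq_le_sum_add_of_mem_ellipsoid {a : ℕ+ → ℝ} (ha : ∀ j, 0 < a j)
    (ha_mono : Monotone a) {δ : EllTwo} (hδ : δ ∈ ellipsoid a) (N : ℕ+) :
    ‖δ‖ ^ 2 ≤ ∑ j ∈ Finset.Icc 1 N, δ j ^ 2 + (a N ^ 2)⁻¹ := by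
  have hind : Summable fun j => if j ∈ Finset.Icc 1 N then δ j ^ 2 else 0 :=
    summable_of_ne_finset_zero (s := Finset.Icc 1 N) fun j hj => if_neg hj
  have haN : 0 < a N ^ 2 := pow_pos (ha N) 2
  rw [norm_sq_eq_tsum]
  calc ∑' j, δ j ^ 2
      ≤ ∑' j, ((if j ∈ Finset.Icc 1 N then δ j ^ 2 else 0) +
          (a N ^ 2)⁻¹ * (a j ^ 2 * δ j ^ 2)) := by
        refine (summable_sq δ).tsum_le_tsum (fun j => ?_) (hind.add (hδ.1.mul_left _))
        split_ifs with hj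
        · have : 0 ≤ (a N ^ 2)⁻¹ * (a j ^ 2 * δ j ^ 2) := by positivity
          linarith
        · have hNj : N ≤ j := by
            by_contra hlt
            exact hj (Finset.mem_Icc.2 ⟨one_le, (not_le.1 hlt).le⟩)
          have : a N ^ 2 ≤ a j ^ 2 := pow_le_pow_left₀ (ha N).le (ha_mono hNj) 2
          rw [zero_add, ← mul_assoc]
          refine le_mul_of_one_le_left (sq_nonneg _) ?_
          rwa [← div_eq_inv_mul, one_le_div haN]
    _ = ∑ j ∈ Finset.Icc 1 N, δ j ^ 2 + (a N ^ 2)⁻¹ * ∑' j, a j ^ 2 * δ j ^ 2 := by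
        rw [hind.tsum_add (hδ.1.mul_left _), tsum_mul_left,
          tsum_eq_sum (s := Finset.Icc 1 N) fun j hj => if_neg hj]
        congr 1
        exact Finset.sum_congr rfl fun j hj => if_pos hj
    _ ≤ _ := by
        have := mul_le_mul_of_nonneg_left hδ.2 (inv_pos.2 haN).le
        linarith

/-- Minkowski's inequality with the `τ` part measured in ℓ¹: its ℓ² norm is at most its ℓ¹ norm, and
the latter is at most `Bd` by the ellipsoid constraint. -/
theorem sum_weights_sq_le {a b : ℕ+ → ℝ} (ha : ∀ j, 0 < a j) (hb : ∀ j, 0 < b j) {ε τ Bd : ℝ}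
    {θ : EllTwo} (hθ : θ ∈ ellipsoid a) {S : Finset ℕ+} (hBd0 : 0 ≤ Bd)
    (hBd : ∀ j ∈ S, τ ^ 2 * (a j * b j)⁻¹ ^ 2 ≤ Bd) :
    ∑ j ∈ S, ((ε ^ 2 + τ ^ 2 * θ j ^ 2) / b j ^ 2) ^ 2 ≤
      (ε ^ 2 * √(∑ j ∈ S, (b j ^ 4)⁻¹) + Bd) ^ 2 := by
  set A := ε ^ 2 * √(∑ j ∈ S, (b j ^ 4)⁻¹) with hA
  have hA0 : 0 ≤ A := by positivity
  have hAsq : A ^ 2 = ∑ j ∈ S, (ε ^ 2 / b j ^ 2) ^ 2 := by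
    rw [hA, mul_pow, Real.sq_sqrt (Finset.sum_nonneg fun j _ => by have := hb j; positivity),
      Finset.mul_sum]
    refine Finset.sum_congr rfl fun j _ => ?_
    rw [div_pow]
    ring
  have hpA : ∀ j ∈ S, ε ^ 2 / b j ^ 2 ≤ A := by
    intro j hj
    refine le_of_sq_le_sq ?_ hA0
    rw [hAsq]
    exact Finset.single_le_sum (f := fun j => (ε ^ 2 / b j ^ 2) ^ 2) (fun i _ => sq_nonneg _) hj
  have hq0 : ∀ j, 0 ≤ τ ^ 2 * θ j ^ 2 / b j ^ 2 := fun j => by positivity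
  have hqsum : ∑ j ∈ S, τ ^ 2 * θ j ^ 2 / b j ^ 2 ≤ Bd := by
    calc ∑ j ∈ S, τ ^ 2 * θ j ^ 2 / b j ^ 2
        ≤ ∑ j ∈ S, Bd * (a j ^ 2 * θ j ^ 2) := by
          refine Finset.sum_le_sum fun j hj => ?_
          have h1 := mul_le_mul_of_nonneg_right (hBd j hj)
            (show 0 ≤ a j ^ 2 * θ j ^ 2 by positivity)
          refine le_of_eq_of_le ?_ h1
          have := (ha j).ne'
          have := (hb j).ne'
          field_simp
      _ = Bd * ∑ j ∈ S, a j ^ 2 * θ j ^ 2 := by rw [Finset.mul_sum]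
      _ ≤ Bd * 1 := by
          refine mul_le_mul_of_nonneg_left ?_ hBd0
          exact (hθ.1.sum_le_tsum S fun j _ => by positivity).trans hθ.2
      _ = Bd := mul_one _
  have hcross : ∑ j ∈ S, ε ^ 2 / b j ^ 2 * (τ ^ 2 * θ j ^ 2 / b j ^ 2) ≤ A * Bd := by
    calc _ ≤ ∑ j ∈ S, A * (τ ^ 2 * θ j ^ 2 / b j ^ 2) :=
          Finset.sum_le_sum fun j hj => mul_le_mul_of_nonneg_right (hpA j hj) (hq0 j)
      _ = A * ∑ j ∈ S, τ ^ 2 * θ j ^ 2 / b j ^ 2 := by rw [Finset.mul_sum]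
      _ ≤ _ := mul_le_mul_of_nonneg_left hqsum hA0
  have hqq : ∑ j ∈ S, (τ ^ 2 * θ j ^ 2 / b j ^ 2) ^ 2 ≤ Bd ^ 2 :=
    (Finset.sum_sq_le_sq_sum_of_nonneg fun j _ => hq0 j).trans
      (pow_le_pow_left₀ (Finset.sum_nonneg fun j _ => hq0 j) hqsum 2)
  have hexpand : ∑ j ∈ S, ((ε ^ 2 + τ ^ 2 * θ j ^ 2) / b j ^ 2) ^ 2 =
      ∑ j ∈ S, (ε ^ 2 / b j ^ 2) ^ 2 +
        2 * ∑ j ∈ S, ε ^ 2 / b j ^ 2 * (τ ^ 2 * θ j ^ 2 / b j ^ 2) +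
        ∑ j ∈ S, (τ ^ 2 * θ j ^ 2 / b j ^ 2) ^ 2 := by
    rw [Finset.mul_sum, ← Finset.sum_add_distrib, ← Finset.sum_add_distrib]
    refine Finset.sum_congr rfl fun j _ => ?_
    ring
  rw [hexpand, ← hAsq]
  nlinarith

/-- The chi-square test attains the radius `r` when the residuals `ζ` are Gaussian with mean
`ν (θ - θ₀)` and variance `ε² + τ² θ₀²`. -/
theorem minimaxRadius_le_of_residuals {α β : ℝ} (hα : 0 < α) (hβ : 0 < β) {a b : ℕ+ → ℝ}
    (ha : ∀ j, 0 < a j) (ha_mono : Monotone a) (hb : ∀ j, 0 < b j) {C₀ C₁ : ℝ} (hC₀ : 0 < C₀)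
    {ε σ τ : ℝ} (hε : 0 < ε) (ζ : EllTwo → ℕ+ → ℝ × ℝ → ℝ)
    (hζ : ∀ θ₀ j, Measurable (ζ θ₀ j))
    (hmap : ∀ θ₀ θ : EllTwo, ∀ ν ∈ operatorClass C₀ C₁ b, ∀ j,
      ((gaussianReal (ν j * θ j) (ε ^ 2).toNNReal).prod
        (gaussianReal (ν j) (σ ^ 2).toNNReal)).map (ζ θ₀ j) =
        gaussianReal (ν j * (θ j - θ₀ j)) (ε ^ 2 + τ ^ 2 * θ₀ j ^ 2).toNNReal)
    (N : ℕ+) {Bd : ℝ} (hBd0 : 0 ≤ Bd) (hBd : ∀ j ≤ N, τ ^ 2 * (a j * b j)⁻¹ ^ 2 ≤ Bd) {r : ℝ}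
    (hr : 0 < r)
    (hrad : 6 * (ε ^ 2 * √(∑ j ∈ Finset.Icc 1 N, (b j ^ 4)⁻¹) + Bd) *
      (Real.log (1 / α) + Real.log (1 / β) + 3 / 16) ≤ C₀ ^ 2 * (r ^ 2 - (a N ^ 2)⁻¹)) :
    minimaxRadius a (operatorClass C₀ C₁ b) α β ε σ ≤ ENNReal.ofReal r := by
  set S := Finset.Icc 1 N with hS
  set W := ε ^ 2 * √(∑ j ∈ S, (b j ^ 4)⁻¹) + Bd with hW
  have hW0 : 0 < W := by
    have hs : 0 < ∑ j ∈ S, (b j ^ 4)⁻¹ := Finset.sum_pos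
      (fun j _ => by have := hb j; positivity) ⟨1, Finset.mem_Icc.2 ⟨le_rfl, one_le⟩⟩
    have := Real.sqrt_pos.2 hs
    positivity
  -- The factor `b_j⁻²` makes every coordinate of `θ - θ₀` count equally up to `C₀²`, and `4W`
  -- brings the ℓ² norm of `t_j v_j` down to at most `1/4`.
  let t : ℕ+ → ℝ := fun j => (4 * W * b j ^ 2)⁻¹
  let v : EllTwo → ℕ+ → ℝ≥0 := fun θ₀ j => (ε ^ 2 + τ ^ 2 * θ₀ j ^ 2).toNNReal
  have hvpos : ∀ (θ₀ : EllTwo) (j : ℕ+), 0 < ε ^ 2 + τ ^ 2 * θ₀ j ^ 2 := fun θ₀ j => by positivity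
  have hv : ∀ θ₀ j, v θ₀ j ≠ 0 := fun θ₀ j => by simpa [v] using hvpos θ₀ j
  have ht : ∀ j, 0 ≤ t j := fun j => by simp only [t]; positivity
  have hsum : ∀ θ₀ ∈ ellipsoid a, ∑ j ∈ S, (t j * v θ₀ j) ^ 2 ≤ 1 / 16 := by
    intro θ₀ hθ₀
    have h := sum_weights_sq_le (ε := ε) (τ := τ) ha hb hθ₀ hBd0 (S := S)
      fun j hj => hBd j (Finset.mem_Icc.1 hj).2
    have heq : ∀ j, (t j * v θ₀ j : ℝ) ^ 2 =
        (16 * W ^ 2)⁻¹ * ((ε ^ 2 + τ ^ 2 * θ₀ j ^ 2) / b j ^ 2) ^ 2 := by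
      intro j
      simp only [t, v]
      rw [Real.coe_toNNReal _ (hvpos θ₀ j).le]
      have := (hb j).ne'
      field_simp
      ring
    rw [Finset.sum_congr rfl fun j _ => heq j, ← Finset.mul_sum, inv_mul_le_iff₀ (by positivity)]
    linarith
  let T : EllTwo → Obs → ℝ := fun θ₀ => chiSquareStat S t (v θ₀) (ζ θ₀)
  have hT : ∀ θ₀, Measurable (T θ₀) := fun θ₀ => measurable_chiSquareStat S t (v θ₀) (hζ θ₀)
  let Ψ : Procedure := fun θ₀ z => decide (Real.log (1 / α) + 1 / 8 ≤ T θ₀ z)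
  have hlevel : IsLevelTest a (operatorClass C₀ C₁ b) α ε σ Ψ := by
    refine ⟨fun θ₀ => measurable_to_bool ?_, fun θ₀ hθ₀ ν hν => ?_⟩
    · have : Ψ θ₀ ⁻¹' {true} = {z | Real.log (1 / α) + 1 / 8 ≤ T θ₀ z} := by
        ext z
        simp [Ψ]
      rw [this]
      exact measurableSet_le measurable_const (hT θ₀)
    · have h := measure_chiSquareStat_ge_le (hζ θ₀) (hv θ₀) ht (hsum θ₀ hθ₀.1)
        (fun j => (gaussianReal (ν j * θ₀ j) (ε ^ 2).toNNReal).prod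
          (gaussianReal (ν j) (σ ^ 2).toNNReal))
        (fun j => by simpa using hmap θ₀ θ₀ ν hν j) (Real.log (1 / α))
      rw [one_div, Real.log_inv, neg_neg, Real.exp_log hα] at h
      refine le_trans (measure_mono fun z hz => ?_) h
      simpa [Ψ, T] using hz
  refine (iInf₂_le Ψ hlevel).trans (iInf₂_le r ⟨hr, ?_⟩)
  refine iSup₂_le fun θ₀ hθ₀ => iSup₂_le fun θ hθ => iSup₂_le fun ν hν => ?_
  have h := measure_chiSquareStat_lt_le (hζ θ₀) (hv θ₀) ht (hsum θ₀ hθ₀.1)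
    (fun j => (gaussianReal (ν j * θ j) (ε ^ 2).toNNReal).prod
      (gaussianReal (ν j) (σ ^ 2).toNNReal)) (fun j => ν j * (θ j - θ₀ j))
    (hmap θ₀ θ ν hν) (Real.log (1 / α) + 1 / 8)
  refine le_trans (measure_mono fun z hz => ?_) (h.trans (ENNReal.ofReal_le_ofReal ?_))
  · simpa [Ψ, T] using hz
  rw [← Real.le_log_iff_exp_le hβ]
  have hsignal : C₀ ^ 2 / (4 * W) * (r ^ 2 - (a N ^ 2)⁻¹) ≤
      ∑ j ∈ S, t j * (ν j * (θ j - θ₀ j)) ^ 2 := by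
    have hnorm := norm_sq_le_sum_add_of_mem_ellipsoid ha ha_mono hθ.1 N
    have hr2 : r ^ 2 ≤ ‖θ - θ₀‖ ^ 2 := pow_le_pow_left₀ hr.le hθ.2 2
    calc C₀ ^ 2 / (4 * W) * (r ^ 2 - (a N ^ 2)⁻¹)
        ≤ C₀ ^ 2 / (4 * W) * ∑ j ∈ S, (θ - θ₀) j ^ 2 := by
          refine mul_le_mul_of_nonneg_left ?_ (by positivity)
          linarith
      _ = ∑ j ∈ S, C₀ ^ 2 / (4 * W) * (θ j - θ₀ j) ^ 2 := by
          rw [Finset.mul_sum]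
          rfl
      _ ≤ _ := by
          refine Finset.sum_le_sum fun j _ => ?_
          have hbj := hb j
          have hνj : (C₀ * b j) ^ 2 ≤ ν j ^ 2 := pow_le_pow_left₀ (by positivity) (hν j).1 2
          rw [mul_pow, ← mul_assoc]
          refine mul_le_mul_of_nonneg_right ?_ (sq_nonneg _)
          simp only [t]
          rw [inv_mul_eq_div, div_le_div_iff₀ (by positivity) (by positivity)]
          nlinarith
  -- Here `3/16` is the `1/8` in the threshold plus the `1/16` of the second deviation bound, and
  -- `2/3 · 1/4` produces the 6 of `hrad`.
  have hmul : Real.log (1 / α) + Real.log (1 / β) + 3 / 16 ≤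
      2 / 3 * (C₀ ^ 2 / (4 * W) * (r ^ 2 - (a N ^ 2)⁻¹)) := by
    have : 2 / 3 * (C₀ ^ 2 / (4 * W) * (r ^ 2 - (a N ^ 2)⁻¹)) =
        C₀ ^ 2 * (r ^ 2 - (a N ^ 2)⁻¹) / (6 * W) := by
      field_simp
      ring
    rw [this, le_div_iff₀ (by positivity)]
    linarith
  have hlogβ : Real.log β = -Real.log (1 / β) := by rw [one_div, Real.log_inv, neg_neg]
  linarith

end UpperBound

/-! ### Bandwidths and comparison of constants -/

section Cutoff

theorem one_le_kappa : 1 ≤ kappa := by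
  unfold kappa
  nlinarith [sq_nonneg Real.pi]

theorem hOne_le_hZero (α : ℝ) (j : ℕ+) : hOne α j ≤ hZero α j := by
  unfold hOne hZero
  have h1 := Real.sqrt_nonneg (Real.log (kappa * (j : ℝ) ^ 2 / α))
  have h2 := Real.sqrt_nonneg (2 * Real.log (10 / α))
  linarith

theorem log_le_hZero_sq {α : ℝ} (hα : 0 < α) (hα1 : α ≤ 1) (j : ℕ+) :
    Real.log j ≤ hZero α j ^ 2 := by
  have hj : (1 : ℝ) ≤ j := by exact_mod_cast j.pos
  have hle : (j : ℝ) ≤ kappa * (j : ℝ) ^ 2 / α := by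
    rw [le_div_iff₀ hα]
    have := one_le_kappa
    nlinarith [mul_le_mul_of_nonneg_right this (sq_nonneg (j : ℝ))]
  have hlog : Real.log j ≤ Real.log (kappa * (j : ℝ) ^ 2 / α) :=
    Real.log_le_log (by linarith) hle
  have hlog0 : 0 ≤ Real.log (kappa * (j : ℝ) ^ 2 / α) := (Real.log_nonneg hj).trans hlog
  refine hlog.trans ?_
  conv_lhs => rw [← Real.sq_sqrt hlog0]
  refine pow_le_pow_left₀ (Real.sqrt_nonneg _) ?_ 2
  unfold hZero
  have h1 := Real.sqrt_nonneg (Real.log (kappa * (j : ℝ) ^ 2 / α))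
  have h2 := Real.sqrt_nonneg (2 * Real.log (10 / α))
  linarith

/-- The `- 1` in `M₀` keeps `N` strictly before the first crossing; as indices start at 1, the
truncated subtraction loses nothing. -/
theorem mul_hZero_lt_of_le_bandM₀ {α σ : ℝ} {b : ℕ+ → ℝ} {N : ℕ+}
    (hN : ((N : ℕ) : ℕ∞) ≤ bandM₀ α σ b) {j : ℕ+} (hj : j ≤ N) : σ * hZero α j < b j := by
  by_contra! hcon
  have h1 : bandM₀ α σ b ≤ (((j : ℕ) - 1 : ℕ) : ℕ∞) := by
    unfold bandM₀
    push_cast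
    exact tsub_le_tsub_right (iInf₂_le (f := fun (j : ℕ+) (_ : b j ≤ σ * hZero α j) =>
      ((j : ℕ) : ℕ∞)) j hcon) 1
  have h2 : (N : ℕ) ≤ (j : ℕ) - 1 := by exact_mod_cast hN.trans h1
  have h3 : (j : ℕ) ≤ N := hj
  have := j.pos
  omega

/-- Since `h_{1,j} ≤ h_{0,j}`, a cut-off below `M₀` is also below `M₁`; this places the indices used
by the test inside the sum of the upper bound. -/
theorem le_bandM₁ {α σ : ℝ} (hσ : 0 < σ) {b : ℕ+ → ℝ} {N : ℕ+}
    (hN : ∀ j ≤ N, σ * hZero α j < b j) : ((N : ℕ) : ℕ∞) ≤ bandM₁ α σ b := by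
  refine le_iInf₂ fun j hj => ?_
  by_contra! hlt
  have hjN : (j : ℕ) ≤ N := by exact_mod_cast hlt.le
  have h1 := hN j hjN
  have h2 := mul_le_mul_of_nonneg_left (hOne_le_hZero α j) hσ.le
  linarith

/-- If the contribution of the noise on the singular values is dominated by the remainder term, the
chi-square test attains the upper bound. -/
theorem minimaxRadius_sq_le_upperTerm {α β : ℝ} (hα : 0 < α) (hαβ : α ≤ β) (hβ : β < 1)
    {a b : ℕ+ → ℝ} (ha : ∀ j, 0 < a j) (ha_mono : Monotone a) (hb : ∀ j, 0 < b j) {C₀ C₁ : ℝ}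
    (hC₀ : 0 < C₀) {ε σ τ : ℝ} (hε : 0 < ε) (hσ : 0 < σ)
    (ζ : EllTwo → ℕ+ → ℝ × ℝ → ℝ) (hζ : ∀ θ₀ j, Measurable (ζ θ₀ j))
    (hmap : ∀ θ₀ θ : EllTwo, ∀ ν ∈ operatorClass C₀ C₁ b, ∀ j,
      ((gaussianReal (ν j * θ j) (ε ^ 2).toNNReal).prod
        (gaussianReal (ν j) (σ ^ 2).toNNReal)).map (ζ θ₀ j) =
        gaussianReal (ν j * (θ j - θ₀ j)) (ε ^ 2 + τ ^ 2 * θ₀ j ^ 2).toNNReal)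
    (hbias : ∀ N : ℕ+, σ * hZero α N < b N → ∃ Bd : ℝ, 0 ≤ Bd ∧
      (∀ j ≤ N, τ ^ 2 * (a j * b j)⁻¹ ^ 2 ≤ Bd) ∧
      (2 * Real.log (1 / α) + 3 / 16) * Bd ≤
        C₀ ^ 2 * max (σ ^ 2 * Real.log (1 / σ) ^ (3 / 2 : ℝ)) (a N ^ 2)⁻¹) (D : ℕ+) :
    minimaxRadius a (operatorClass C₀ C₁ b) α β ε σ ^ 2 ≤ upperTerm a b α β C₀ ε σ D := by
  unfold upperTerm
  set n := (min ((D : ℕ) : ℕ∞) (bandM₀ α σ b)).toNat with hn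
  set G := 7 + 4 * √(Real.log (2 / α)) with hG
  have hG7 : 7 ≤ G := by
    have := Real.sqrt_nonneg (Real.log (2 / α))
    linarith
  have hnle : (n : ℕ∞) = min ((D : ℕ) : ℕ∞) (bandM₀ α σ b) :=
    ENat.natCast_toNat (ne_top_of_le_ne_top (ENat.natCast_ne_top _) (min_le_left _ _))
  rcases Nat.eq_zero_or_pos n with hn0 | hn0
  -- With `M₀ = 0` the convention `a_0⁻² = ∞` makes the right-hand side infinite.
  · have : ENNReal.ofReal G ≠ 0 := by
      simpa using (show 0 < G by linarith)
    rw [invSq, dif_neg (by omega), max_eq_right le_top, ENNReal.mul_top this, add_top]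
    exact le_top
  set N : ℕ+ := ⟨n, hn0⟩ with hN
  have hND : N ≤ D := by
    have : (n : ℕ∞) ≤ ((D : ℕ) : ℕ∞) := hnle.trans_le (min_le_left _ _)
    have h' : n ≤ (D : ℕ) := by exact_mod_cast this
    exact h'
  have hNM₀ : ((N : ℕ) : ℕ∞) ≤ bandM₀ α σ b := hnle.trans_le (min_le_right _ _)
  have hgap : ∀ j ≤ N, σ * hZero α j < b j := fun j hj => mul_hZero_lt_of_le_bandM₀ hNM₀ hj
  have hNM₁ := le_bandM₁ hσ hgap
  obtain ⟨Bd, hBd0, hBd, hBdle⟩ := hbias N (hgap N le_rfl)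
  rw [invSq, dif_pos hn0, ← hN]
  set s := ∑ j ∈ (Finset.Icc 1 D).filter (fun j : ℕ+ => ((j : ℕ) : ℕ∞) ≤ bandM₁ α σ b),
    (b j ^ 4)⁻¹ with hs
  set Z := max (σ ^ 2 * Real.log (1 / σ) ^ (3 / 2 : ℝ)) (a N ^ 2)⁻¹ with hZ
  have haN : 0 < (a N ^ 2)⁻¹ := inv_pos.2 (pow_pos (ha N) 2)
  have hZpos : 0 < Z := lt_max_of_lt_right haN
  have hZge : (a N ^ 2)⁻¹ ≤ Z := le_max_right _ _
  have hsub : ∑ j ∈ Finset.Icc 1 N, (b j ^ 4)⁻¹ ≤ s := by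
    refine Finset.sum_le_sum_of_subset_of_nonneg (fun j hj => ?_)
      fun j _ _ => by have := hb j; positivity
    have hjN := (Finset.mem_Icc.1 hj).2
    refine Finset.mem_filter.2 ⟨Finset.mem_Icc.2 ⟨one_le, hjN.trans hND⟩, ?_⟩
    refine le_trans ?_ hNM₁
    have : (j : ℕ) ≤ N := hjN
    exact_mod_cast this
  have hsqrt := Real.sqrt_le_sqrt hsub
  have hxα : 0 < Real.log (1 / α) := Real.log_pos (by rw [lt_div_iff₀ hα]; linarith)
  have hβ0 : 0 < β := hα.trans_le hαβ
  have hxβ : 0 < Real.log (1 / β) := Real.log_pos (by rw [lt_div_iff₀ hβ0]; linarith)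
  have hxβα : Real.log (1 / β) ≤ Real.log (1 / α) :=
    Real.log_le_log (by positivity) (one_div_le_one_div_of_le hα hαβ)
  have hl : Real.log (2 / α) = Real.log 2 + Real.log (1 / α) := by
    rw [← Real.log_mul two_ne_zero (by positivity)]
    congr 1
    ring
  have hC : 12 * Real.log (1 / α) + 9 / 8 ≤ C₀ ^ 2 * tildeC α β C₀ := by
    have h1 := Real.sqrt_nonneg (Real.log (2 / α))
    have h2 := Real.sqrt_nonneg (Real.log (2 / β))
    have h3 : C₀ ^ 2 * tildeC α β C₀ = 16 * (3 * √(Real.log (2 / α)) + 2 * Real.log (2 / α) +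
        3 * √(Real.log (2 / β))) := by
      unfold tildeC
      field_simp
    have h4 := Real.log_two_gt_d9
    rw [h3]
    linarith
  have hCpos : 0 ≤ tildeC α β C₀ := by
    have h1 : 0 < C₀ ^ 2 * tildeC α β C₀ := by linarith
    exact (pos_of_mul_pos_right h1 (by positivity)).le
  set U := tildeC α β C₀ * ε ^ 2 * √s + G * Z with hU
  have hX0 : 0 ≤ tildeC α β C₀ * ε ^ 2 * √s := by positivity
  have hU0 : 0 < U := by
    have : 0 < G * Z := by positivity
    linarith
  have hterm : ENNReal.ofReal (tildeC α β C₀ * ε ^ 2 * √s) + ENNReal.ofReal G *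
      max (ENNReal.ofReal (σ ^ 2 * Real.log (1 / σ) ^ (3 / 2 : ℝ)))
        (ENNReal.ofReal (a N ^ 2)⁻¹) = ENNReal.ofReal U := by
    rw [← ENNReal.ofReal_max, ← ENNReal.ofReal_mul (by linarith),
      ← ENNReal.ofReal_add hX0 (by positivity)]
  rw [hterm]
  have hrad : 6 * (ε ^ 2 * √(∑ j ∈ Finset.Icc 1 N, (b j ^ 4)⁻¹) + Bd) *
      (Real.log (1 / α) + Real.log (1 / β) + 3 / 16) ≤
        C₀ ^ 2 * (√U ^ 2 - (a N ^ 2)⁻¹) := by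
    rw [Real.sq_sqrt hU0.le]
    set A := ε ^ 2 * √(∑ j ∈ Finset.Icc 1 N, (b j ^ 4)⁻¹) with hA
    have hA0 : 0 ≤ A := by positivity
    have hAs : A ≤ ε ^ 2 * √s := mul_le_mul_of_nonneg_left hsqrt (by positivity)
    -- The assumption `α ≤ β` enters here, through `ln (1/β) ≤ ln (1/α)`.
    have e1 : 6 * (A + Bd) * (Real.log (1 / α) + Real.log (1 / β) + 3 / 16) ≤
        (A + Bd) * (12 * Real.log (1 / α) + 9 / 8) := by
      linarith [mul_nonneg (add_nonneg hA0 hBd0) (sub_nonneg.2 hxβα)]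
    have e2 : A * (12 * Real.log (1 / α) + 9 / 8) ≤
        C₀ ^ 2 * (tildeC α β C₀ * ε ^ 2 * √s) := by
      calc A * (12 * Real.log (1 / α) + 9 / 8)
          ≤ ε ^ 2 * √s * (C₀ ^ 2 * tildeC α β C₀) :=
            mul_le_mul hAs hC (by linarith) (by positivity)
        _ = _ := by ring
    have e3 : Bd * (12 * Real.log (1 / α) + 9 / 8) ≤ C₀ ^ 2 * (G * Z - (a N ^ 2)⁻¹) := by
      -- Of the factor `G ≥ 7`, one unit pays for the truncation bias and six for the noise on the
      -- singular values.
      have h6 : C₀ ^ 2 * (6 * Z) ≤ C₀ ^ 2 * (G * Z - (a N ^ 2)⁻¹) := by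
        refine mul_le_mul_of_nonneg_left ?_ (sq_nonneg _)
        linarith [mul_nonneg (sub_nonneg.2 hG7) hZpos.le]
      linarith
    rw [hU]
    linarith
  have hmain := minimaxRadius_le_of_residuals hα hβ0 ha ha_mono hb hC₀ hε ζ hζ hmap N hBd0 hBd
    (Real.sqrt_pos.2 hU0) hrad
  refine (pow_le_pow_left₀ zero_le hmain 2).trans ?_
  rw [← ENNReal.ofReal_pow (Real.sqrt_nonneg _), Real.sq_sqrt hU0.le]

/-- Since `h_{0,N}² ≥ ln N` tends to infinity, the first alternative fails for finitely many `N`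
only, and `y` is bounded on those. -/
theorem exists_bound_of_hZero_sq_lt {α : ℝ} (hα : 0 < α) (hα1 : α ≤ 1) (Q : ℝ) (y : ℕ+ → ℝ) :
    ∃ Λ, Q ≤ Λ ∧ ∀ N : ℕ+, Q ≤ hZero α N ^ 2 ∨ y N ≤ Λ := by
  obtain ⟨n, hn⟩ := exists_nat_ge (Real.exp Q)
  have hfin : {N : ℕ+ | (N : ℕ) < n}.Finite :=
    Set.Finite.preimage PNat.coe_injective.injOn (Set.finite_lt_nat n)
  obtain ⟨M, hM⟩ := (hfin.image y).bddAbove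
  refine ⟨max Q M, le_max_left _ _, fun N => ?_⟩
  by_cases hN : (N : ℕ) < n
  · exact Or.inr ((hM (Set.mem_image_of_mem y hN)).trans (le_max_right _ _))
  · refine Or.inl (le_trans ?_ (log_le_hZero_sq hα hα1 N))
    rw [Real.le_log_iff_exp_le (by exact_mod_cast N.pos)]
    refine hn.trans ?_
    exact_mod_cast not_lt.1 hN

theorem le_log_rpow_of_le_exp_neg {Λ σ : ℝ} (hΛ : 1 ≤ Λ) (hσ : 0 < σ) (h : σ ≤ Real.exp (-Λ)) :
    Λ ≤ Real.log (1 / σ) ^ (3 / 2 : ℝ) := by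
  have hlog : Λ ≤ Real.log (1 / σ) := by
    rw [one_div, Real.log_inv]
    have := (Real.log_le_iff_le_exp hσ).2 h
    linarith
  exact hlog.trans (Real.self_le_rpow_of_one_le (hΛ.trans hlog) (by norm_num))

end Cutoff

/-! ### Upper bounds for known and for unknown singular values -/

theorem upper_bound_of_known_operator {α β : ℝ} (hα : 0 < α) (hαβ : α ≤ β) (hβ : β < 1)
    {a b : ℕ+ → ℝ} (ha : ∀ j, 0 < a j) (ha_mono : Monotone a) (hb : ∀ j, 0 < b j)
    {ε σ : ℝ} (hε : 0 < ε) (hσ : 0 < σ) (D : ℕ+) :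
    minimaxRadius a (operatorClass 1 1 b) α β ε σ ^ 2 ≤ upperTerm a b α β 1 ε σ D := by
  refine minimaxRadius_sq_le_upperTerm (τ := 0) hα hαβ hβ ha ha_mono hb one_pos hε hσ
    (fun θ₀ j p => p.1 - b j * θ₀ j) (fun θ₀ j => by fun_prop) ?_ ?_ D
  · intro θ₀ θ ν hν j
    have hνb : ν j = b j := by
      have := hν j
      linarith
    have h1 : ((gaussianReal (ν j * θ j) (ε ^ 2).toNNReal).prod
        (gaussianReal (ν j) (σ ^ 2).toNNReal)).map Prod.fst =
          gaussianReal (ν j * θ j) (ε ^ 2).toNNReal := by simp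
    have h2 := gaussianReal_map_sub_const (μ := ν j * θ j) (v := (ε ^ 2).toNNReal) (b j * θ₀ j)
    rw [← h1, Measure.map_map (by fun_prop) (by fun_prop)] at h2
    rw [Function.comp_def] at h2
    rw [h2, hνb]
    congr 2
    · ring
    · ring
  · intro N _
    refine ⟨0, le_rfl, fun j _ => by simp, ?_⟩
    have : 0 ≤ (a N ^ 2)⁻¹ := by positivity
    have := this.trans (le_max_right (σ ^ 2 * Real.log (1 / σ) ^ (3 / 2 : ℝ)) _)
    rw [mul_zero]
    positivity

theorem exists_upper_bound_of_almostMonotone {α β : ℝ} (hα : 0 < α) (hαβ : α ≤ β) (hβ : β < 1)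
    {a b : ℕ+ → ℝ} (ha : ∀ j, 0 < a j) (ha_mono : Monotone a) (hb : ∀ j, 0 < b j) {C₀ C₁ : ℝ}
    (hC₀ : 0 < C₀) (hab : BoundedOrAlmostMonotone a b) :
    ∃ σ₀ : ℝ, 0 < σ₀ ∧ σ₀ < 1 ∧ ∀ σ : ℝ, 0 < σ → σ ≤ σ₀ → ∀ ε : ℝ, 0 < ε → ∀ D : ℕ+,
      minimaxRadius a (operatorClass C₀ C₁ b) α β ε σ ^ 2 ≤ upperTerm a b α β C₀ ε σ D := by
  obtain ⟨K, hK⟩ := hab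
  set y : ℕ+ → ℝ := fun j => (a j * b j)⁻¹ with hy
  have hypos : ∀ j, 0 < y j := fun j => inv_pos.2 (mul_pos (ha j) (hb j))
  set c := (2 * Real.log (1 / α) + 3 / 16) / C₀ ^ 2 with hc
  have hxα : 0 < Real.log (1 / α) := Real.log_pos (by rw [lt_div_iff₀ hα]; linarith)
  have hcpos : 0 < c := by positivity
  obtain ⟨Λ, hΛ, hΛ'⟩ := exists_bound_of_hZero_sq_lt hα (by linarith) (c * K ^ 2)
    fun N => c * K ^ 2 * y N ^ 2
  set Λ₁ := max Λ 1 with hΛ₁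
  -- Taking `Λ₁ ≥ 1` makes `ln (1/σ) ≥ 1`, so the power `3/2` only increases it and the logarithmic
  -- factor exceeds `Λ`.
  refine ⟨Real.exp (-Λ₁), Real.exp_pos _, Real.exp_lt_one_iff.2 ?_, fun σ hσ hσle ε hε D => ?_⟩
  · have : 1 ≤ Λ₁ := le_max_right _ _
    linarith
  have hΛ1 : 1 ≤ Λ₁ := le_max_right _ _
  have hL : Λ ≤ Real.log (1 / σ) ^ (3 / 2 : ℝ) :=
    (le_max_left _ _).trans (le_log_rpow_of_le_exp_neg hΛ1 hσ hσle)
  refine minimaxRadius_sq_le_upperTerm (τ := σ) hα hαβ hβ ha ha_mono hb hC₀ hε hσ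
    (fun θ₀ j p => p.1 - θ₀ j * p.2) (fun θ₀ j => by fun_prop) ?_ ?_ D
  · intro θ₀ θ ν _ j
    rw [map_sub_mul_prod_gaussianReal]
    congr 1
    · ring
    · rw [← Real.toNNReal_mul (sq_nonneg _),
        ← Real.toNNReal_add (sq_nonneg _) (by positivity), mul_comm (σ ^ 2)]
  · intro N hN
    refine ⟨σ ^ 2 * (K * max 1 (y N)) ^ 2, by positivity, fun j hj => ?_, ?_⟩
    · refine mul_le_mul_of_nonneg_left ?_ (sq_nonneg _)
      exact pow_le_pow_left₀ (hypos j).le (hK j N hj) 2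
    · have hgoal : c * (σ ^ 2 * (K * max 1 (y N)) ^ 2) ≤
          max (σ ^ 2 * Real.log (1 / σ) ^ (3 / 2 : ℝ)) (a N ^ 2)⁻¹ := by
        have hσ2 : 0 < σ ^ 2 := pow_pos hσ 2
        rcases le_total 1 (y N) with h1 | h1
        · rw [max_eq_right h1]
          rcases hΛ' N with h2 | h2
          -- Large `h_{0,N}`: from `b_N > σ h_{0,N}` the factor `c K² σ² / b_N²` is at most 1,
          -- leaving `a_N⁻²`.
          · refine le_max_of_le_right ?_
            have haN := ha N
            have hbN := hb N
            have hh : hZero α N ^ 2 * σ ^ 2 ≤ b N ^ 2 := by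
              rw [← mul_pow]
              refine pow_le_pow_left₀ ?_ (by linarith) 2
              refine mul_nonneg ?_ hσ.le
              unfold hZero
              positivity
            have hQ : c * K ^ 2 * σ ^ 2 ≤ b N ^ 2 :=
              (mul_le_mul_of_nonneg_right h2 hσ2.le).trans hh
            have heq : c * (σ ^ 2 * (K * y N) ^ 2) =
                c * K ^ 2 * σ ^ 2 / b N ^ 2 * (a N ^ 2)⁻¹ := by
              simp only [hy]
              field_simp
            rw [heq]
            exact mul_le_of_le_one_left (by positivity)
              (div_le_one_of_le₀ hQ (by positivity))
          · refine le_max_of_le_left ?_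
            have := mul_le_mul_of_nonneg_left (h2.trans hL) hσ2.le
            linarith
        · rw [max_eq_left h1, mul_one]
          refine le_max_of_le_left ?_
          have := mul_le_mul_of_nonneg_left (hΛ.trans hL) hσ2.le
          linarith
      have := mul_le_mul_of_nonneg_left hgoal (show 0 ≤ C₀ ^ 2 by positivity)
      refine le_of_eq_of_le ?_ this
      rw [hc]
      field_simp

end GoF

theorem theorem1 (α β : ℝ) (hα : 0 < α) (hαβ : α ≤ β) (hβ : β < 1)
    (a : ℕ+ → ℝ) (ha_pos : ∀ j, 0 < a j) (ha_mono : Monotone a) (ha_lim : Tendsto a atTop atTop)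
    (b : ℕ+ → ℝ) (hb_pos : ∀ j, 0 < b j)
    (C₀ C₁ : ℝ) (hC₀ : 0 < C₀) (hC₀' : C₀ ≤ 1) (hC₁ : 1 ≤ C₁) :
    ((C₀ = 1 ∧ C₁ = 1) ∨ GoF.BoundedOrAlmostMonotone a b →
      ∃ σ₀ : ℝ, 0 < σ₀ ∧ σ₀ < 1 ∧ ∀ σ : ℝ, 0 < σ → σ ≤ σ₀ → ∀ ε : ℝ, 0 < ε →
        GoF.minimaxRadius a (GoF.operatorClass C₀ C₁ b) α β ε σ ^ 2 ≤
          ⨅ D : ℕ+, GoF.upperTerm a b α β C₀ ε σ D) ∧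
    (α + β < 1 → Antitone b → ∀ ε : ℝ, 0 < ε → ∀ σ : ℝ, 0 < σ →
      max (GoF.lowerSigma a b α β C₀ C₁ σ) (GoF.lowerEps a b α β ε) ≤
        GoF.minimaxRadius a (GoF.operatorClass C₀ C₁ b) α β ε σ ^ 2) := by
  have hβ0 : 0 < β := hα.trans_le hαβ
  refine ⟨?_, fun hsum hanti ε hε σ hσ => max_le ?_ ?_⟩
  · rintro (⟨rfl, rfl⟩ | hab)
    -- The value `1/2` is arbitrary: with known singular values the bound holds for every `σ > 0`.
    · exact ⟨1 / 2, by norm_num, by norm_num, fun σ hσ _ ε hε => le_iInf fun D =>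
        GoF.upper_bound_of_known_operator hα hαβ hβ ha_pos ha_mono hb_pos hε hσ D⟩
    · obtain ⟨σ₀, h0, h1, h⟩ := GoF.exists_upper_bound_of_almostMonotone (C₁ := C₁) hα hαβ hβ
        ha_pos ha_mono hb_pos hC₀ hab
      exact ⟨σ₀, h0, h1, fun σ hσ hσle ε hε => le_iInf fun D => h σ hσ hσle ε hε D⟩
  · exact GoF.lowerSigma_le_minimaxRadius_sq hα hβ0 hsum hC₀' hC₁ ha_pos hb_pos hanti hσ
  · exact GoF.lowerEps_le_minimaxRadius_sq hα hβ0 hsum hC₀' hC₁ ha_pos ha_mono hb_pos hε
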